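/- Let $\mathfrak M$ be the space of (classes modulo a.e. equality of) complex-valued, Lebesgue measurable, a.e. finite functions on $(0,\infty)$, and for $f\in\mathfrak M$ let $f^*(t)=\inf\{\lambda>0:|\{|f|>\lambda\}|\le t\}$, $t>0$, be its non-increasing rearrangement. A rearrangement-invariant quasi-Banach function space $E$ is a quasi-Banach space of the form $E=\{f\in\mathfrak M:\rho_E(f^*)<\infty\}$ with quasi-norm $\|f\|_E=\rho_E(f^*)$ (where $\rho_E(g)=\infty$ if $g\notin\mathfrak M$), for some $\rho_E:\mathfrak M\to[0,\infty]$ such that: $\rho_E$ is a quasi-norm (with values in $[0,\infty]$); $|g|\le|f|$ a.e. implies $\rho_E(g)\le\rho_E(f)$; if $0\le f_n\nearrow f$ a.e. with $f_n,f\in\mathfrak M$, then $\rho_E(f_n)\nearrow\rho_E(f)$; and $\rho_E(\chi_\omega)<\infty$ for every measurable $\omega\subset(0,\infty)$ of finite measure. For $a>0$ let $(D_af)(t)=f(at)$ and let $\|D_a\|$ be the norm of $D_a$ as an operator from $E$ to $E$. The Boyd indices of $E$ are $$p_E=\sup\{p>0:\exists c>0\ \forall\,0<a<1\ \ \|D_a\|\le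 ca^{-1/p}\},\qquad q_E=\inf\{q>0:\exists c>0\ \forall\,a\ge1\ \ \|D_a\|\le ca^{-1/q}\},$$ with values in $[0,\infty]$ and $\inf\emptyset=\infty$. For a compatible couple $(X_0,X_1)$ of quasi-normed spaces let $K(t,x;X_0,X_1)=\inf\{\|x_0\|_{X_0}+t\|x_1\|_{X_1}:x=x_0+x_1,\ x_i\in X_i\}$, and for $0<\Theta,r<\infty$ let $(X_0,X_1)_{\Theta,r;E}$ be the space of all $x\in X_0+X_1$ with $$\|x\|_{(X_0,X_1)_{\Theta,r;E}}=\rho_E\bigl(t^{-1/r}K(t^{1/\Theta},x;X_0,X_1)\bigr)<\infty.$$ Let $X_0\cap X_1$ carry the quasi-norm $\max\{\|x\|_{X_0},\|x\|_{X_1}\}$ and $X_0+X_1$ the quasi-norm $K(1,x;X_0,X_1)$. Write $X\subset Y$ for continuous embedding ($\|x\|_Y\le C\|x\|_X$ for all $x\in X$, with a constant $C$), and $X=Y$ if $X\subset Y$ and $Y\subset X$, that is, the spaces coincide and their quasi-norms are equivalent. Let $L_p$ be the Lebesgue spaces on $(0,\infty)$. Corollary 16. Let $E$ be a rearrangement-invariant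 quasi-Banach function space and $0<p_0<p_1\le\infty$. Assume that $p_0<p_E$ and that either (i) $q_E<p_1<\infty$ and $\frac1\Theta=\frac1{p_0}-\frac1{p_1}$, or (ii) $p_1=\infty$ (with $q_E\le\infty$ arbitrary) and $\Theta=p_0$. Then $$(L_{p_0},L_{p_1})_{\Theta,p_0;E}=E .$$ In particular, $L_{p_0}\cap L_{p_1}\subset E\subset L_{p_0}+L_{p_1}$. -/

import Mathlib

open MeasureTheory Set Filter Topology
open scoped ENNReal NNReal ComplexOrder

noncomputable section

/-! ### Measurable functions on the half-line -/

/-- Lebesgue measure on `(0, ∞)`. -/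
abbrev halfLine : Measure ℝ := volume.restrict (Ioi (0 : ℝ))

/-- The space `𝔐(0, ∞)` of complex-valued, measurable, a.e. finite functions on `(0, ∞)`, where
functions that coincide almost everywhere are identified. -/
abbrev MeasFun : Type := ℝ →ₘ[halfLine] ℂ

/-- The non-increasing rearrangement
`f^*(t) = inf {s > 0 : |{x : |f x| > s}| ≤ t}`, with value `∞` if there is no finite such `s`. -/
def rearr (f : MeasFun) (t : ℝ) : ℝ≥0∞ :=
  sInf {s : ℝ≥0∞ | 0 < s ∧ halfLine {x | s < ‖f x‖ₑ} ≤ ENNReal.ofReal t}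

theorem quasiMeasurePreserving_dilation {a : ℝ} (ha : 0 < a) :
    Measure.QuasiMeasurePreserving (fun t : ℝ => a * t) halfLine halfLine := by
  refine ⟨measurable_const_mul a, ?_⟩
  intro s hs
  obtain ⟨u, hsu, hu, hu0⟩ := exists_measurable_superset_of_null hs
  refine measure_mono_null hsu ?_
  rw [Measure.map_apply (measurable_const_mul a) hu,
    Measure.restrict_apply (measurable_const_mul a hu)]
  rw [Measure.restrict_apply hu] at hu0
  have h : (fun t : ℝ => a * t) ⁻¹' u ∩ Ioi 0 = (fun t : ℝ => a * t) ⁻¹' (u ∩ Ioi 0) := by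
    ext t
    simp [ha]
  rw [h, Real.volume_preimage_mul_left ha.ne', hu0, mul_zero]

/-- The dilation operator `(D_a f)(t) = f(a t)`, `0 < a < ∞`. -/
def dilation (a : ℝ) (ha : 0 < a) (f : MeasFun) : MeasFun :=
  f.compQuasiMeasurePreserving (fun t : ℝ => a * t) (quasiMeasurePreserving_dilation ha)

/-- The class in `𝔐(0, ∞)` of the characteristic function of a measurable set. -/
def charFun (ω : Set ℝ) (hω : MeasurableSet ω) : MeasFun :=
  AEEqFun.mk (ω.indicator fun _ => (1 : ℂ))
    (stronglyMeasurable_const.indicator hω).aestronglyMeasurable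

/-! ### Quasi-normed spaces

A quasi-normed space sitting inside a vector space `V` is represented by its quasi-norm, extended
by the value `∞` outside of the space: the space is `{x | N x < ∞}`. -/

/-- `N` is a quasi-norm (extended by `∞`) on the complex vector space `V`. -/
structure IsQuasiNorm {V : Type*} [AddCommGroup V] [Module ℂ V] (N : V → ℝ≥0∞) : Prop where
  eq_zero_iff : ∀ x, N x = 0 ↔ x = 0
  smul : ∀ (c : ℂ) (x : V), N (c • x) = ‖c‖ₑ * N x
  add_le : ∃ C : ℝ≥0, 1 ≤ C ∧ ∀ x y, N (x + y) ≤ C * (N x + N y)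

/-- Every Cauchy sequence of the space `{x | N x < ∞}` converges in it. -/
def IsCompleteQuasiNorm {V : Type*} [AddCommGroup V] (N : V → ℝ≥0∞) : Prop :=
  ∀ u : ℕ → V, (∀ n, N (u n) < ∞) →
    (∀ ε : ℝ≥0∞, 0 < ε → ∃ n₀, ∀ m ≥ n₀, ∀ n ≥ n₀, N (u m - u n) < ε) →
    ∃ x, N x < ∞ ∧ Tendsto (fun n => N (u n - x)) atTop (𝓝 0)

/-- Continuous embedding of the space given by `N` into the space given by `M`. -/
def ContEmbedded {V : Type*} (N M : V → ℝ≥0∞) : Prop :=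
  ∃ C : ℝ≥0, 0 < C ∧ ∀ x, N x < ∞ → M x ≤ C * N x

/-- The two spaces coincide and their quasi-norms are equivalent. -/
def SameSpace {V : Type*} (N M : V → ℝ≥0∞) : Prop :=
  ContEmbedded N M ∧ ContEmbedded M N

/-- The operator (quasi-)norm of `T` on the space given by `N` (`∞` if `T` is not bounded). -/
def opQuasiNorm {V : Type*} (N : V → ℝ≥0∞) (T : V → V) : ℝ≥0∞ :=
  sInf {C : ℝ≥0∞ | ∀ x, N x < ∞ → N (T x) ≤ C * N x}

/-- The quasi-norm of the intersection `X₀ ∩ X₁`. -/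
def interQuasiNorm {V : Type*} (N₀ N₁ : V → ℝ≥0∞) (x : V) : ℝ≥0∞ :=
  max (N₀ x) (N₁ x)

/-- Peetre's `K`-functional
`K(t, x; X₀, X₁) = inf {‖x₀‖ + t ‖x₁‖ : x = x₀ + x₁, x₀ ∈ X₀, x₁ ∈ X₁}`
(with value `∞` if `x` does not belong to `X₀ + X₁`). -/
def peetreK {V : Type*} [AddCommGroup V] (N₀ N₁ : V → ℝ≥0∞) (t : ℝ) (x : V) : ℝ≥0∞ :=
  ⨅ (x₀ : V) (x₁ : V) (_ : x = x₀ + x₁ ∧ N₀ x₀ < ∞ ∧ N₁ x₁ < ∞),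
    N₀ x₀ + ENNReal.ofReal t * N₁ x₁

/-- The quasi-norm of the sum `X₀ + X₁`. -/
def sumQuasiNorm {V : Type*} [AddCommGroup V] (N₀ N₁ : V → ℝ≥0∞) (x : V) : ℝ≥0∞ :=
  ⨅ (x₀ : V) (x₁ : V) (_ : x = x₀ + x₁ ∧ N₀ x₀ < ∞ ∧ N₁ x₁ < ∞), N₀ x₀ + N₁ x₁

/-- The (quasi-)norm of the Lebesgue space `L_p` on `(0, ∞)`, `0 < p ≤ ∞`. -/
def lebesgueQuasiNorm (p : ℝ≥0∞) (f : MeasFun) : ℝ≥0∞ :=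
  eLpNorm f p halfLine

/-! ### Rearrangement-invariant quasi-Banach function spaces -/

open Classical in
/-- The value of a functional `ρ : 𝔐(0, ∞) → [0, ∞]` at a `[0, ∞]`-valued function `g` on
`(0, ∞)`; it is `∞` if `g` does not belong to `𝔐(0, ∞)`, i.e. if `g` is not measurable or not
finite almost everywhere. -/
def evalNonneg (ρ : MeasFun → ℝ≥0∞) (g : ℝ → ℝ≥0∞) : ℝ≥0∞ :=
  if h : AEMeasurable g halfLine ∧ ∀ᵐ t ∂halfLine, g t < ∞ then
    ρ (AEEqFun.mk (fun t => ((g t).toReal : ℂ))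
      (Complex.measurable_ofReal.comp_aemeasurable h.1.ennreal_toReal).aestronglyMeasurable)
  else ∞

/-- A rearrangement-invariant quasi-Banach function space `E` over `(0, ∞)`, given by the
functional `ρ`: the space `E` consists of all `f` with `‖f‖_E = ρ(f^*) < ∞`. -/
structure RIQuasiBanachSpace where
  /-- the functional `ρ_E : 𝔐(0, ∞) → [0, ∞]` -/
  ρ : MeasFun → ℝ≥0∞
  quasiNorm_ρ : IsQuasiNorm ρ
  lattice : ∀ f g : MeasFun, (∀ᵐ t ∂halfLine, ‖g t‖ ≤ ‖f t‖) → ρ g ≤ ρ f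
  fatou : ∀ (u : ℕ → MeasFun) (f : MeasFun),
    (∀ᵐ t ∂halfLine, (∀ n, 0 ≤ u n t ∧ u n t ≤ u (n + 1) t) ∧
      Tendsto (fun n => u n t) atTop (𝓝 (f t))) →
    Tendsto (fun n => ρ (u n)) atTop (𝓝 (ρ f))
  finite_charFun : ∀ (ω : Set ℝ) (hω : MeasurableSet ω), halfLine ω < ∞ → ρ (charFun ω hω) < ∞
  quasiNorm_rearr : IsQuasiNorm fun f : MeasFun => evalNonneg ρ (rearr f)
  complete_rearr : IsCompleteQuasiNorm fun f : MeasFun => evalNonneg ρ (rearr f)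

namespace RIQuasiBanachSpace

/-- The quasi-norm `‖f‖_E = ρ_E(f^*)`. -/
def norm (E : RIQuasiBanachSpace) (f : MeasFun) : ℝ≥0∞ :=
  evalNonneg E.ρ (rearr f)

/-- The norm `‖D_a‖_{E → E}` of the dilation operator. -/
def dilationNorm (E : RIQuasiBanachSpace) (a : ℝ) (ha : 0 < a) : ℝ≥0∞ :=
  opQuasiNorm E.norm (dilation a ha)

/-- The lower Boyd index `p_E`. -/
def lowerBoyd (E : RIQuasiBanachSpace) : ℝ≥0∞ :=
  sSup {P : ℝ≥0∞ | ∃ p : ℝ, 0 < p ∧ P = ENNReal.ofReal p ∧ ∃ c : ℝ, 0 < c ∧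
    ∀ (a : ℝ) (ha : 0 < a), a < 1 →
      E.dilationNorm a ha ≤ ENNReal.ofReal (c * a ^ (-(1 / p)))}

/-- The upper Boyd index `q_E` (`∞` if the set is empty). -/
def upperBoyd (E : RIQuasiBanachSpace) : ℝ≥0∞ :=
  sInf {Q : ℝ≥0∞ | ∃ q : ℝ, 0 < q ∧ Q = ENNReal.ofReal q ∧ ∃ c : ℝ, 0 < c ∧
    ∀ (a : ℝ) (ha : 0 < a), 1 ≤ a →
      E.dilationNorm a ha ≤ ENNReal.ofReal (c * a ^ (-(1 / q)))}

/-- The quasi-norm of the space `(X₀, X₁)_{Θ,r;E}`, for `0 < Θ, r < ∞`: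
`ρ_E(t^{-1/r} K(t^{1/Θ}, x; X₀, X₁))`. It is `∞` if `x` does not belong to `X₀ + X₁`, since then
the `K`-functional is identically `∞`. -/
def interpQuasiNorm (E : RIQuasiBanachSpace) {V : Type*} [AddCommGroup V]
    (N₀ N₁ : V → ℝ≥0∞) (Θ r : ℝ) (x : V) : ℝ≥0∞ :=
  evalNonneg E.ρ fun t =>
    ENNReal.ofReal (t ^ (-(1 / r))) * peetreK N₀ N₁ (t ^ (1 / Θ)) x

end RIQuasiBanachSpace

end

/-! Both inclusions in the main identity come from comparing `f^*(t)` with `t^{-1/p₀} K(t^{1/Θ},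
f)`.

`E` contains the interpolation space pointwise, without Boyd indices. If `f = f₀ + f₁`, then `f^*(t)
≤ f₀^*(t/2) + f₁^*(t/2)`, and Chebyshev gives `f_i^*(u) ≤ u^{-1/p_i} ‖f_i‖`. As `1/Θ = 1/p₀ - 1/p₁`,
this yields `f^*(t) ≤ 2^{1/p₀} t^{-1/p₀} K(t^{1/Θ}, f)` (`rearr_le_peetreK`).

For the converse, `f` is cut at height `f^*(t)`. The two `L_p` norms are split into layers between
the values of `f^*` at `t b^{±n}`, which bounds `t^{-1/p₀} K(t^{1/Θ}, f)` by series of weighted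
dilations of `f^*` (`eLpNorm_truncGT_le`, `eLpNorm_truncLE_le`). By the Boyd conditions the `n`-th
term has `ρ`-value at most a constant times `r^n ‖f‖_E`, where `r → 0` as `b → ∞`. For `b` large
this decay beats the factors `C^{n+1}` of the iterated quasi-triangle inequality, so no equivalent
`p`-norm is needed (`evalNonneg_tsum_geometric_le`).

Both remaining embeddings follow from the identity and from properties of `K`: `K(1, x)` is
controlled by testing on `(1, 2)`, and `K(s, f) ≤ min(1, s) max(‖f‖₀, ‖f‖₁)` is compared with the
`K`-functional of `χ_(0,1)`, which lies in `E`. -/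

/-- The class in `𝔐(0, ∞)` of the real-valued version of a `[0, ∞]`-valued function. -/
noncomputable def ofNonneg (g : ℝ → ℝ≥0∞) (hg : AEMeasurable g halfLine) : MeasFun :=
  AEEqFun.mk (fun t => ((g t).toReal : ℂ))
    (Complex.measurable_ofReal.comp_aemeasurable hg.ennreal_toReal).aestronglyMeasurable

theorem coeFn_ofNonneg (g : ℝ → ℝ≥0∞) (hg : AEMeasurable g halfLine) :
    ∀ᵐ t ∂halfLine, ofNonneg g hg t = ((g t).toReal : ℂ) :=
  AEEqFun.coeFn_mk _ _

theorem evalNonneg_eq (ρ : MeasFun → ℝ≥0∞) {g : ℝ → ℝ≥0∞} (hg : AEMeasurable g halfLine)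
    (hfin : ∀ᵐ t ∂halfLine, g t < ∞) : evalNonneg ρ g = ρ (ofNonneg g hg) :=
  dif_pos ⟨hg, hfin⟩

theorem evalNonneg_eq_top (ρ : MeasFun → ℝ≥0∞) {g : ℝ → ℝ≥0∞}
    (hfin : ¬ ∀ᵐ t ∂halfLine, g t < ∞) : evalNonneg ρ g = ∞ :=
  dif_neg fun h => hfin h.2

theorem ae_lt_top_of_evalNonneg {ρ : MeasFun → ℝ≥0∞} {g : ℝ → ℝ≥0∞}
    (h : evalNonneg ρ g < ∞) : AEMeasurable g halfLine ∧ ∀ᵐ t ∂halfLine, g t < ∞ := by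
  by_contra hc
  rw [evalNonneg, dif_neg hc] at h
  exact lt_irrefl _ h

theorem coeFn_charFun {ω : Set ℝ} (hω : MeasurableSet ω) :
    charFun ω hω =ᵐ[halfLine] ω.indicator fun _ => (1 : ℂ) :=
  AEEqFun.coeFn_mk _ _

/-! ### Calculus of `ρ` on nonnegative functions: quasi-triangle inequality, Fatou property,
infinite sums -/

namespace RIQuasiBanachSpace

variable (E : RIQuasiBanachSpace)

theorem evalNonneg_mono {g h : ℝ → ℝ≥0∞} (hh : AEMeasurable h halfLine)
    (hle : ∀ᵐ t ∂halfLine, h t ≤ g t) : evalNonneg E.ρ h ≤ evalNonneg E.ρ g := by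
  by_cases hg : AEMeasurable g halfLine ∧ ∀ᵐ t ∂halfLine, g t < ∞
  · have hfin : ∀ᵐ t ∂halfLine, h t < ∞ := by
      filter_upwards [hle, hg.2] with t h1 h2 using h1.trans_lt h2
    rw [evalNonneg_eq _ hh hfin, evalNonneg_eq _ hg.1 hg.2]
    refine E.lattice _ _ ?_
    filter_upwards [coeFn_ofNonneg h hh, coeFn_ofNonneg g hg.1, hle, hg.2] with t h1 h2 h3 h4
    rw [h1, h2, Complex.norm_real, Complex.norm_real, Real.norm_of_nonneg ENNReal.toReal_nonneg,
      Real.norm_of_nonneg ENNReal.toReal_nonneg]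
    exact ENNReal.toReal_mono h4.ne h3
  · rw [evalNonneg, evalNonneg, dif_neg hg]
    exact le_top

theorem evalNonneg_const_mul (c : ℝ≥0) {g : ℝ → ℝ≥0∞} (hg : AEMeasurable g halfLine)
    (hfin : ∀ᵐ t ∂halfLine, g t < ∞) :
    evalNonneg E.ρ (fun t => c * g t) = c * evalNonneg E.ρ g := by
  have hcg : AEMeasurable (fun t => (c : ℝ≥0∞) * g t) halfLine := hg.const_mul _
  have hcfin : ∀ᵐ t ∂halfLine, (c : ℝ≥0∞) * g t < ∞ := by
    filter_upwards [hfin] with t ht using ENNReal.mul_lt_top ENNReal.coe_lt_top ht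
  rw [evalNonneg_eq _ hcg hcfin, evalNonneg_eq _ hg hfin]
  have : ofNonneg (fun t => (c : ℝ≥0∞) * g t) hcg = ((c : ℝ) : ℂ) • ofNonneg g hg := by
    refine AEEqFun.ext ?_
    filter_upwards [coeFn_ofNonneg _ hcg, coeFn_ofNonneg g hg,
      AEEqFun.coeFn_smul ((c : ℝ) : ℂ) (ofNonneg g hg)] with t h1 h2 h3
    rw [h1, h3, Pi.smul_apply, h2]
    simp
  rw [this, E.quasiNorm_ρ.smul]
  congr 1
  rw [← ofReal_norm, Complex.norm_real, Real.norm_of_nonneg c.coe_nonneg,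
    ENNReal.ofReal_coe_nnreal]

theorem evalNonneg_const_mul_le {c : ℝ≥0} (hc : c ≠ 0) {g : ℝ → ℝ≥0∞}
    (hg : AEMeasurable g halfLine) :
    evalNonneg E.ρ (fun t => c * g t) ≤ c * evalNonneg E.ρ g := by
  by_cases hfin : ∀ᵐ t ∂halfLine, g t < ∞
  · exact (E.evalNonneg_const_mul c hg hfin).le
  · rw [evalNonneg_eq_top _ hfin, ENNReal.mul_top (by exact_mod_cast hc)]
    exact le_top

theorem exists_evalNonneg_add_le : ∃ C : ℝ≥0, 1 ≤ C ∧ ∀ g h : ℝ → ℝ≥0∞,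
    AEMeasurable g halfLine → AEMeasurable h halfLine →
    evalNonneg E.ρ (fun t => g t + h t) ≤ C * (evalNonneg E.ρ g + evalNonneg E.ρ h) := by
  obtain ⟨C, hC1, hC⟩ := E.quasiNorm_ρ.add_le
  refine ⟨C, hC1, fun g h hg hh => ?_⟩
  have hC0 : (C : ℝ≥0∞) ≠ 0 := by
    have : C ≠ 0 := (zero_lt_one.trans_le hC1).ne'
    exact_mod_cast this
  by_cases hgf : ∀ᵐ t ∂halfLine, g t < ∞
  swap
  · rw [evalNonneg_eq_top _ hgf, top_add, ENNReal.mul_top hC0]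
    exact le_top
  by_cases hhf : ∀ᵐ t ∂halfLine, h t < ∞
  swap
  · rw [evalNonneg_eq_top _ hhf, add_top, ENNReal.mul_top hC0]
    exact le_top
  have hs : AEMeasurable (fun t => g t + h t) halfLine := hg.add hh
  have hsf : ∀ᵐ t ∂halfLine, g t + h t < ∞ := by
    filter_upwards [hgf, hhf] with t h1 h2 using ENNReal.add_lt_top.2 ⟨h1, h2⟩
  rw [evalNonneg_eq _ hg hgf, evalNonneg_eq _ hh hhf, evalNonneg_eq _ hs hsf]
  have : ofNonneg (fun t => g t + h t) hs = ofNonneg g hg + ofNonneg h hh := by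
    refine AEEqFun.ext ?_
    filter_upwards [coeFn_ofNonneg _ hs, coeFn_ofNonneg g hg, coeFn_ofNonneg h hh,
      AEEqFun.coeFn_add (ofNonneg g hg) (ofNonneg h hh), hgf, hhf] with t h1 h2 h3 h4 h5 h6
    rw [h1, h4, Pi.add_apply, h2, h3, ENNReal.toReal_add h5.ne h6.ne, Complex.ofReal_add]
  rw [this]
  exact hC _ _

theorem ae_eq_zero_of_evalNonneg_eq_zero {g : ℝ → ℝ≥0∞} (h : evalNonneg E.ρ g = 0) :
    ∀ᵐ t ∂halfLine, g t = 0 := by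
  obtain ⟨hg, hfin⟩ := ae_lt_top_of_evalNonneg (h.trans_lt ENNReal.zero_lt_top)
  rw [evalNonneg_eq _ hg hfin, E.quasiNorm_ρ.eq_zero_iff] at h
  have h0 := AEEqFun.coeFn_zero (α := ℝ) (β := ℂ) (μ := halfLine)
  rw [← h] at h0
  filter_upwards [h0, coeFn_ofNonneg g hg, hfin] with t h1 h2 h3
  rw [h2] at h1
  have : (g t).toReal = 0 := by simpa using h1
  rcases (ENNReal.toReal_eq_zero_iff _).1 this with h | h
  · exact h
  · exact absurd h h3.ne

theorem evalNonneg_iSup_le_of_finite {u : ℕ → ℝ → ℝ≥0∞} (hu : ∀ n, AEMeasurable (u n) halfLine)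
    (hmono : ∀ t, Monotone fun n => u n t) (hfin : ∀ᵐ t ∂halfLine, ⨆ n, u n t < ∞) :
    evalNonneg E.ρ (fun t => ⨆ n, u n t) ≤ ⨆ n, evalNonneg E.ρ (u n) := by
  have hs : AEMeasurable (fun t => ⨆ n, u n t) halfLine := AEMeasurable.iSup hu
  have hufin : ∀ n, ∀ᵐ t ∂halfLine, u n t < ∞ := fun n => by
    filter_upwards [hfin] with t ht using (le_iSup (fun n => u n t) n).trans_lt ht
  have key : Tendsto (fun n => E.ρ (ofNonneg (u n) (hu n))) atTop
      (𝓝 (E.ρ (ofNonneg (fun t => ⨆ n, u n t) hs))) := by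
    refine E.fatou _ _ ?_
    filter_upwards [hfin, ae_all_iff.2 fun n => coeFn_ofNonneg (u n) (hu n), coeFn_ofNonneg _ hs]
      with t h1 h2 h3
    have hlt : ∀ n, u n t < ∞ := fun n => (le_iSup (fun n => u n t) n).trans_lt h1
    refine ⟨fun n => ?_, ?_⟩
    · rw [h2, h2]
      exact ⟨Complex.zero_le_real.2 ENNReal.toReal_nonneg, Complex.real_le_real.2
        (ENNReal.toReal_mono (hlt _).ne (hmono t n.le_succ))⟩
    · simp only [h2, h3]
      exact (Complex.continuous_ofReal.tendsto _).comp
        ((ENNReal.tendsto_toReal h1.ne).comp (tendsto_atTop_iSup (hmono t)))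
  rw [evalNonneg_eq _ hs hfin]
  refine le_of_tendsto' key fun n => ?_
  rw [← evalNonneg_eq E.ρ (hu n) (hufin n)]
  exact le_iSup (fun n => evalNonneg E.ρ (u n)) n

/-- The Fatou property, where finiteness of the limit is part of the conclusion. -/
theorem evalNonneg_iSup_le {u : ℕ → ℝ → ℝ≥0∞} (hu : ∀ n, AEMeasurable (u n) halfLine)
    (hmono : ∀ t, Monotone fun n => u n t) :
    evalNonneg E.ρ (fun t => ⨆ n, u n t) ≤ ⨆ n, evalNonneg E.ρ (u n) := by
  set B := ⨆ n, evalNonneg E.ρ (u n) with hB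
  by_cases hBtop : B = ∞
  · rw [hBtop]; exact le_top
  refine E.evalNonneg_iSup_le_of_finite hu hmono ?_
  have hs : AEMeasurable (fun t => ⨆ n, u n t) halfLine := AEMeasurable.iSup hu
  -- With `χ` the indicator of the set where the supremum is infinite, `k χ ≤ sup_n min(u_n, k)` for
  -- every `k`. The truncated supremum is finite, so the Fatou property gives `k ρ(χ) ≤ B` for all
  -- `k`. Hence `ρ(χ) = 0` and the set is null.
  let χ : ℝ → ℝ≥0∞ := fun t => ({∞} : Set ℝ≥0∞).indicator (fun _ => 1) (⨆ n, u n t)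
  have hχ : AEMeasurable χ halfLine :=
    (measurable_const.indicator (measurableSet_singleton _)).comp_aemeasurable hs
  have hχfin : ∀ᵐ t ∂halfLine, χ t < ∞ := by
    refine Eventually.of_forall fun t => ?_
    refine (indicator_le_self' (fun _ _ => zero_le) _).trans_lt ENNReal.one_lt_top
  have hk : ∀ k : ℕ, (k : ℝ≥0∞) * evalNonneg E.ρ χ ≤ B := fun k => by
    have h1 : evalNonneg E.ρ (fun t => ⨆ n, min (u n t) k) ≤
        ⨆ n, evalNonneg E.ρ (fun t => min (u n t) k) := by
      refine E.evalNonneg_iSup_le_of_finite (fun n => (hu n).min aemeasurable_const)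
        (fun t m n hmn => min_le_min_right _ (hmono t hmn)) ?_
      exact Eventually.of_forall fun t =>
        (iSup_le fun n => min_le_right _ _).trans_lt (ENNReal.natCast_lt_top k)
    have h2 : ⨆ n, evalNonneg E.ρ (fun t => min (u n t) k) ≤ B :=
      iSup_mono fun n => E.evalNonneg_mono ((hu n).min aemeasurable_const)
        (Eventually.of_forall fun t => min_le_left _ _)
    have h3 := E.evalNonneg_const_mul (k : ℝ≥0) hχ hχfin
    have h4 : evalNonneg E.ρ (fun t => ((k : ℝ≥0) : ℝ≥0∞) * χ t) ≤
        evalNonneg E.ρ (fun t => ⨆ n, min (u n t) k) := by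
      refine E.evalNonneg_mono (hχ.const_mul _) (Eventually.of_forall fun t => ?_)
      by_cases ht : ⨆ n, u n t = ∞
      · have : ⨆ n, min (u n t) (k : ℝ≥0∞) = k := by
          rw [← iSup_inf_eq, ht, top_inf_eq]
        rw [this]
        simp [χ, ht]
      · simp [χ, ht]
    rw [h3] at h4
    simpa using h4.trans (h1.trans h2)
  have hχ0 : evalNonneg E.ρ χ = 0 := by
    by_contra h0
    obtain ⟨k, hk'⟩ := ENNReal.exists_nat_mul_gt h0 hBtop
    exact absurd (hk k) (not_le.2 hk')
  filter_upwards [E.ae_eq_zero_of_evalNonneg_eq_zero hχ0] with t ht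
  by_contra hc
  rw [not_lt, top_le_iff] at hc
  simp [χ, hc] at ht

/-- Splitting off the first term at each stage costs one factor `C` for everything that remains, so
the `n`-th term collects `C^{n+1}`. -/
theorem evalNonneg_sum_le {C : ℝ≥0}
    (hC : ∀ g h : ℝ → ℝ≥0∞, AEMeasurable g halfLine → AEMeasurable h halfLine →
      evalNonneg E.ρ (fun t => g t + h t) ≤ C * (evalNonneg E.ρ g + evalNonneg E.ρ h))
    (N : ℕ) (g : ℕ → ℝ → ℝ≥0∞) (hg : ∀ n, AEMeasurable (g n) halfLine) :
    evalNonneg E.ρ (fun t => ∑ n ∈ Finset.range N, g n t) ≤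
      ∑ n ∈ Finset.range N, (C : ℝ≥0∞) ^ (n + 1) * evalNonneg E.ρ (g n) := by
  induction N generalizing g with
  | zero =>
    have h := E.evalNonneg_const_mul 0 (g := fun _ => 0) aemeasurable_const
      (Eventually.of_forall fun _ => ENNReal.zero_lt_top)
    simpa using h
  | succ N ih =>
    simp only [Finset.sum_range_succ' _ N]
    refine (hC _ _ (Finset.aemeasurable_fun_sum _ fun n _ => hg (n + 1)) (hg 0)).trans ?_
    rw [mul_add, zero_add, pow_one]
    gcongr
    refine (mul_le_mul_right (ih (fun n => g (n + 1)) fun n => hg (n + 1)) _).trans ?_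
    rw [Finset.mul_sum]
    refine Finset.sum_le_sum fun n _ => ?_
    rw [← mul_assoc, ← pow_succ']

theorem evalNonneg_tsum_le {C : ℝ≥0}
    (hC : ∀ g h : ℝ → ℝ≥0∞, AEMeasurable g halfLine → AEMeasurable h halfLine →
      evalNonneg E.ρ (fun t => g t + h t) ≤ C * (evalNonneg E.ρ g + evalNonneg E.ρ h))
    (g : ℕ → ℝ → ℝ≥0∞) (hg : ∀ n, AEMeasurable (g n) halfLine) :
    evalNonneg E.ρ (fun t => ∑' n, g n t) ≤
      ∑' n, (C : ℝ≥0∞) ^ (n + 1) * evalNonneg E.ρ (g n) := by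
  have h : (fun t => ∑' n, g n t) = fun t => ⨆ N, ∑ n ∈ Finset.range N, g n t :=
    funext fun t => ENNReal.tsum_eq_iSup_nat
  rw [h]
  refine (E.evalNonneg_iSup_le (u := fun N t => ∑ n ∈ Finset.range N, g n t)
    (fun N => Finset.aemeasurable_fun_sum _ fun n _ => hg n) fun t m n hmn =>
      Finset.sum_le_sum_of_subset (Finset.range_mono hmn)).trans ?_
  exact iSup_le fun N => (E.evalNonneg_sum_le hC N g hg).trans (ENNReal.sum_le_tsum _)

end RIQuasiBanachSpace

/-! ### Rearrangements and dilations -/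

theorem rearr_antitone (f : MeasFun) : Antitone (rearr f) := fun _ _ hst =>
  sInf_le_sInf fun _ h => ⟨h.1, h.2.trans (ENNReal.ofReal_le_ofReal hst)⟩

theorem measurable_rearr (f : MeasFun) : Measurable (rearr f) :=
  (rearr_antitone f).measurable

/-- The infimum defining `f^*(t)` keeps the measure bound: along a sequence of admissible levels
decreasing to it, the level sets increase to `{|f| > f^*(t)}`. -/
theorem measure_rearr_lt_enorm (f : MeasFun) (t : ℝ) :
    halfLine {x | rearr f t < ‖f x‖ₑ} ≤ ENNReal.ofReal t := by
  set S := {s : ℝ≥0∞ | 0 < s ∧ halfLine {x | s < ‖f x‖ₑ} ≤ ENNReal.ofReal t} with hS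
  have hne : S.Nonempty := ⟨∞, ENNReal.zero_lt_top, by simp⟩
  obtain ⟨u, hu, hlim, huS⟩ := exists_seq_tendsto_sInf hne (OrderBot.bddBelow S)
  have h : {x | rearr f t < ‖f x‖ₑ} = ⋃ n, {x | u n < ‖f x‖ₑ} := by
    ext x
    simp only [mem_ofPred_eq, mem_iUnion]
    refine ⟨fun hx => (hlim.eventually_lt_const hx).exists, ?_⟩
    rintro ⟨n, hn⟩
    exact (sInf_le (huS n)).trans_lt hn
  have hmono : Monotone fun n => {x | u n < ‖f x‖ₑ} := fun m n hmn x (hx : u m < _) =>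
    (hu hmn).trans_lt hx
  rw [h, hmono.measure_iUnion]
  exact iSup_le fun n => (huS n).2

theorem measure_preimage_dilation {a : ℝ} (ha : 0 < a) {A : Set ℝ} (hA : MeasurableSet A) :
    halfLine ((fun t => a * t) ⁻¹' A) = ENNReal.ofReal a⁻¹ * halfLine A := by
  rw [Measure.restrict_apply (measurable_const_mul a hA), Measure.restrict_apply hA]
  have h : (fun t : ℝ => a * t) ⁻¹' A ∩ Ioi 0 = (fun t : ℝ => a * t) ⁻¹' (A ∩ Ioi 0) := by
    ext t
    simp [ha]
  rw [h, Real.volume_preimage_mul_left ha.ne', abs_of_pos (inv_pos.2 ha)]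

theorem rearr_dilation {a : ℝ} (ha : 0 < a) (f : MeasFun) (t : ℝ) :
    rearr (dilation a ha f) t = rearr f (a * t) := by
  have hae : ∀ s : ℝ≥0∞, halfLine {x | s < ‖dilation a ha f x‖ₑ} =
      ENNReal.ofReal a⁻¹ * halfLine {x | s < ‖f x‖ₑ} := fun s => by
    rw [← measure_preimage_dilation ha
      (measurableSet_lt measurable_const f.stronglyMeasurable.measurable.enorm)]
    refine measure_congr ?_
    filter_upwards [AEEqFun.coeFn_compQuasiMeasurePreserving f
      (quasiMeasurePreserving_dilation ha)] with x hx
    have hx' : dilation a ha f x = f (a * x) := hx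
    change (s < ‖dilation a ha f x‖ₑ) = (s < ‖f (a * x)‖ₑ)
    rw [hx']
  unfold rearr
  congr 1
  ext s
  rw [mem_ofPred_eq, mem_ofPred_eq, hae, ENNReal.ofReal_mul ha.le, ENNReal.ofReal_inv_of_pos ha,
    ENNReal.inv_mul_le_iff (ENNReal.ofReal_pos.2 ha).ne' ENNReal.ofReal_ne_top]

theorem opQuasiNorm_bound {V : Type*} {N : V → ℝ≥0∞} {T : V → V} {A : ℝ≥0∞} (hA : A ≠ ∞)
    (h : opQuasiNorm N T ≤ A) {x : V} (hx : N x < ∞) : N (T x) ≤ A * N x := by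
  have hne : (opQuasiNorm N T) < ∞ := h.trans_lt hA.lt_top
  obtain ⟨C, hC, -⟩ := sInf_lt_iff.1 hne
  -- Division by `N x` fails when `N x = 0`. There any admissible constant suffices, and one exists
  -- because the infimum is finite.
  by_cases h0 : N x = 0
  · have := hC x hx
    rw [h0, mul_zero] at this ⊢
    exact this
  · rw [← ENNReal.div_le_iff h0 hx.ne]
    refine le_trans (le_sInf fun B hB => ?_) h
    rw [ENNReal.div_le_iff h0 hx.ne]
    exact hB x hx

theorem RIQuasiBanachSpace.evalNonneg_rearr_dilate_le (E : RIQuasiBanachSpace) {a B : ℝ}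
    (ha : 0 < a) (h : E.dilationNorm a ha ≤ ENNReal.ofReal B) {f : MeasFun} (hf : E.norm f < ∞) :
    evalNonneg E.ρ (fun t => rearr f (a * t)) ≤ ENNReal.ofReal B * E.norm f := by
  have h1 := opQuasiNorm_bound ENNReal.ofReal_ne_top h hf
  have h2 : rearr (dilation a ha f) = fun t => rearr f (a * t) := funext (rearr_dilation ha f)
  rwa [RIQuasiBanachSpace.norm, h2] at h1

/-! ### The `K`-functional -/

section PeetreK

variable {V : Type*} [AddCommGroup V] (N₀ N₁ : V → ℝ≥0∞)

theorem peetreK_mono (x : V) : Monotone fun t => peetreK N₀ N₁ t x := fun s t hst => by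
  refine iInf_mono fun x₀ => iInf_mono fun x₁ => iInf_mono fun _ => ?_
  gcongr

theorem peetreK_mul_le {c : ℝ} (hc : 1 ≤ c) (s : ℝ) (x : V) :
    peetreK N₀ N₁ (c * s) x ≤ ENNReal.ofReal c * peetreK N₀ N₁ s x := by
  have hc0 : ENNReal.ofReal c ≠ 0 := (ENNReal.ofReal_pos.2 (zero_lt_one.trans_le hc)).ne'
  have h1 : 1 ≤ ENNReal.ofReal c := ENNReal.one_le_ofReal.2 hc
  rw [← ENNReal.inv_mul_le_iff hc0 ENNReal.ofReal_ne_top]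
  refine le_iInf fun x₀ => le_iInf fun x₁ => le_iInf fun h => ?_
  rw [ENNReal.inv_mul_le_iff hc0 ENNReal.ofReal_ne_top]
  refine (iInf_le_of_le x₀ <| iInf_le_of_le x₁ <| iInf_le_of_le h le_rfl).trans ?_
  rw [mul_add, ENNReal.ofReal_mul (zero_le_one.trans hc), mul_assoc]
  gcongr
  exact le_mul_of_one_le_left zero_le h1

theorem sumQuasiNorm_eq_peetreK (x : V) : sumQuasiNorm N₀ N₁ x = peetreK N₀ N₁ 1 x := by
  simp [sumQuasiNorm, peetreK]

theorem peetreK_le_add {t : ℝ} (ht : 0 < t) {x x₀ x₁ : V} (h : x = x₀ + x₁) :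
    peetreK N₀ N₁ t x ≤ N₀ x₀ + ENNReal.ofReal t * N₁ x₁ := by
  by_cases h0 : N₀ x₀ < ∞
  · by_cases h1 : N₁ x₁ < ∞
    · exact iInf_le_of_le x₀ <| iInf_le_of_le x₁ <| iInf_le_of_le ⟨h, h0, h1⟩ le_rfl
    · rw [not_lt, top_le_iff] at h1
      rw [h1, ENNReal.mul_top (ENNReal.ofReal_pos.2 ht).ne', add_top]
      exact le_top
  · rw [not_lt, top_le_iff] at h0
    rw [h0, top_add]
    exact le_top

end PeetreK

/-! ### Pointwise bounds for the couple `(L_{p₀}, L_{p₁})` -/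

/-- Chebyshev's inequality in the form `f^*(u) ≤ u^{-1/p} ‖f‖_p`. For `p = ∞` the convention `1 /
∞.toReal = 0` turns the factor into `1`. -/
theorem measure_mul_eLpNorm_lt_enorm {p : ℝ≥0∞} (hp : p ≠ 0) {u : ℝ} (hu : 0 < u) (f : MeasFun)
    (hf : eLpNorm f p halfLine < ∞) :
    halfLine {x | ENNReal.ofReal (u ^ (-(1 / p.toReal))) * eLpNorm f p halfLine < ‖f x‖ₑ} ≤
      ENNReal.ofReal u := by
  rcases eq_or_ne p ∞ with rfl | hptop
  · have h : ∀ᵐ x ∂halfLine, ‖f x‖ₑ ≤ eLpNorm f ∞ halfLine := by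
      rw [eLpNorm_exponent_top]
      exact ae_le_eLpNormEssSup
    have h0 : halfLine {x | ¬ ‖f x‖ₑ ≤ eLpNorm f ∞ halfLine} = 0 := h
    simp only [not_le] at h0
    rw [ENNReal.toReal_top, div_zero, neg_zero, Real.rpow_zero, ENNReal.ofReal_one, one_mul, h0]
    exact zero_le
  · have hpos : 0 < p.toReal := ENNReal.toReal_pos hp hptop
    set N := eLpNorm f p halfLine with hN
    by_cases hN0 : N = 0
    · have h := (eLpNorm_eq_zero_iff f.aestronglyMeasurable hp).1 hN0
      have h0 : halfLine {x | ¬ f x = 0} = 0 := h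
      rw [hN0, mul_zero]
      refine le_trans (measure_mono fun x hx => ?_) (h0.le.trans zero_le)
      simpa using hx
    · set ε := ENNReal.ofReal (u ^ (-(1 / p.toReal))) * N
      have hε : ε ^ p.toReal = (ENNReal.ofReal u)⁻¹ * N ^ p.toReal := by
        rw [ENNReal.mul_rpow_of_nonneg _ _ hpos.le,
          ENNReal.ofReal_rpow_of_nonneg (Real.rpow_nonneg hu.le _) hpos.le, ← Real.rpow_mul hu.le]
        rw [show -(1 / p.toReal) * p.toReal = -1 by field_simp, Real.rpow_neg_one,
          ENNReal.ofReal_inv_of_pos hu]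
      have hcheb := mul_meas_ge_le_pow_eLpNorm' halfLine hp hptop f.aestronglyMeasurable ε
      rw [hε, ← hN, mul_right_comm] at hcheb
      have hNp0 : N ^ p.toReal ≠ 0 := by
        simp [ENNReal.rpow_eq_zero_iff, hN0, hf.ne]
      have hNpt : N ^ p.toReal ≠ ∞ := (ENNReal.rpow_lt_top_of_nonneg hpos.le hf.ne).ne
      have h1 : (ENNReal.ofReal u)⁻¹ * halfLine {x | ε ≤ ‖f x‖ₑ} ≤ 1 := by
        rw [← ENNReal.mul_le_mul_iff_left hNp0 hNpt, one_mul]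
        exact hcheb
      rw [ENNReal.inv_mul_le_iff (ENNReal.ofReal_pos.2 hu).ne' ENNReal.ofReal_ne_top,
        mul_one] at h1
      exact (measure_mono fun x (hx : ε < _) => hx.le).trans h1

/-- `f^*(t)` is dominated by the `K`-functional of the Lebesgue couple. -/
theorem rearr_le_peetreK {p₀ p₁ : ℝ≥0∞} {θ : ℝ} (hp₀ : p₀ ≠ 0) (hp₁ : p₁ ≠ 0) (hθ : 0 ≤ θ)
    (h : θ = 1 / p₀.toReal - 1 / p₁.toReal) (f : MeasFun) {t : ℝ} (ht : 0 < t) :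
    rearr f t ≤ ENNReal.ofReal (2 ^ (1 / p₀.toReal)) * (ENNReal.ofReal (t ^ (-(1 / p₀.toReal))) *
      peetreK (lebesgueQuasiNorm p₀) (lebesgueQuasiNorm p₁) (t ^ θ) f) := by
  set α := 1 / p₀.toReal
  set β := 1 / p₁.toReal
  have hc : 0 < (2 : ℝ) ^ α * t ^ (-α) := by positivity
  rw [← mul_assoc, ← ENNReal.ofReal_mul (by positivity), mul_comm,
    ← ENNReal.div_le_iff (ENNReal.ofReal_pos.2 hc).ne' ENNReal.ofReal_ne_top]
  refine le_iInf fun f₀ => le_iInf fun f₁ => le_iInf fun ⟨hsum, h0, h1⟩ => ?_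
  rw [ENNReal.div_le_iff (ENNReal.ofReal_pos.2 hc).ne' ENNReal.ofReal_ne_top]
  have ht2 : 0 < t / 2 := by positivity
  have m0 := measure_mul_eLpNorm_lt_enorm hp₀ ht2 f₀ h0
  have m1 := measure_mul_eLpNorm_lt_enorm hp₁ ht2 f₁ h1
  set A := ENNReal.ofReal ((t / 2) ^ (-α)) * eLpNorm f₀ p₀ halfLine
  set B := ENNReal.ofReal ((t / 2) ^ (-β)) * eLpNorm f₁ p₁ halfLine
  have hAB : rearr f t ≤ A + B := by
    -- The slack `ε` is needed because levels in the definition of `f^*` must be positive, while `A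
    -- + B` may vanish.
    refine ENNReal.le_of_forall_pos_le_add fun ε hε _ => sInf_le ⟨?_, ?_⟩
    · exact (ENNReal.coe_pos.2 hε).trans_le le_add_self
    · have hsub : ∀ᵐ x ∂halfLine, A + B + ε < ‖f x‖ₑ → A < ‖f₀ x‖ₑ ∨ B < ‖f₁ x‖ₑ := by
        have := AEEqFun.coeFn_add f₀ f₁
        rw [← hsum] at this
        filter_upwards [this] with x hx hlt
        by_contra! hcon
        refine absurd hlt (not_lt.2 ?_)
        rw [hx, Pi.add_apply]
        exact ((enorm_add_le _ _).trans (add_le_add hcon.1 hcon.2)).trans le_self_add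
      calc halfLine {x | A + B + ε < ‖f x‖ₑ}
          ≤ halfLine ({x | A < ‖f₀ x‖ₑ} ∪ {x | B < ‖f₁ x‖ₑ}) := measure_mono_ae hsub
        _ ≤ _ := measure_union_le _ _
        _ ≤ ENNReal.ofReal (t / 2) + ENNReal.ofReal (t / 2) := add_le_add m0 m1
        _ = ENNReal.ofReal t := by
          rw [← ENNReal.ofReal_add ht2.le ht2.le, add_halves]
  refine hAB.trans ?_
  rw [mul_comm, mul_add, ← mul_assoc, ← ENNReal.ofReal_mul hc.le]
  have hscale : ∀ γ : ℝ, (t / 2) ^ (-γ) = 2 ^ γ * t ^ (-γ) := fun γ => by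
    rw [Real.div_rpow ht.le zero_le_two, Real.rpow_neg zero_le_two, div_inv_eq_mul, mul_comm]
  refine add_le_add ?_ ?_
  · simp only [A, hscale]
    exact le_rfl
  · simp only [B, hscale]
    -- The factor `2^β` is absorbed into `2^α`, since `α - β = θ ≥ 0`.
    refine mul_le_mul_left (ENNReal.ofReal_le_ofReal ?_) _
    rw [mul_assoc, ← Real.rpow_add ht, show -α + θ = -β by rw [h]; ring]
    gcongr
    · exact one_le_two
    · linarith

/-! ### Decomposition into layers -/

/-- The part of `f` where `|f| ≤ s`. -/
noncomputable def truncLE (f : MeasFun) (s : ℝ≥0∞) : MeasFun :=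
  AEEqFun.mk ({x | ‖f x‖ₑ ≤ s}.indicator f) (f.aestronglyMeasurable.indicator
    (measurableSet_le f.stronglyMeasurable.measurable.enorm measurable_const))

/-- The part of `f` where `|f| > s`. -/
noncomputable def truncGT (f : MeasFun) (s : ℝ≥0∞) : MeasFun :=
  AEEqFun.mk ({x | s < ‖f x‖ₑ}.indicator f) (f.aestronglyMeasurable.indicator
    (measurableSet_lt measurable_const f.stronglyMeasurable.measurable.enorm))

theorem truncGT_add_truncLE (f : MeasFun) (s : ℝ≥0∞) : f = truncGT f s + truncLE f s := by
  refine AEEqFun.ext ?_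
  filter_upwards [AEEqFun.coeFn_add (truncGT f s) (truncLE f s),
    AEEqFun.coeFn_mk (μ := halfLine) ({x | ‖f x‖ₑ ≤ s}.indicator f) _,
    AEEqFun.coeFn_mk (μ := halfLine) ({x | s < ‖f x‖ₑ}.indicator f) _] with x h1 h2 h3
  rw [h1, Pi.add_apply, truncGT, truncLE, h2, h3]
  by_cases hx : ‖f x‖ₑ ≤ s
  · simp [indicator, hx, not_lt.2 hx]
  · simp [indicator, hx, not_le.1 hx]

theorem eLpNorm_indicator_eq {p : ℝ≥0∞} (hp : p ≠ 0) (hp' : p ≠ ∞) (f : ℝ → ℂ) {s : Set ℝ}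
    (hs : MeasurableSet s) : eLpNorm (s.indicator f) p halfLine =
      (∫⁻ x in s, ‖f x‖ₑ ^ p.toReal ∂halfLine) ^ (1 / p.toReal) := by
  rw [eLpNorm_indicator_eq_eLpNorm_restrict hs, eLpNorm_eq_lintegral_rpow_enorm_toReal hp hp']

/-- On the layer `σ_n < |f| ≤ v_n` the integrand is at most `v_n^p`, and the layer has measure at
most `τ_n` because `σ_n = f^*(τ_n)`. The layers may overlap. -/
theorem setLIntegral_le_tsum_of_cover {p : ℝ} (hp : 0 < p) (f : MeasFun) {s : Set ℝ}
    (hs : MeasurableSet s) (v σ : ℕ → ℝ≥0∞) (τ : ℕ → ℝ) (hτ : ∀ n, rearr f (τ n) = σ n)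
    (hcover : ∀ᵐ x ∂halfLine, x ∈ s → ‖f x‖ₑ ≠ 0 → ∃ n, σ n < ‖f x‖ₑ ∧ ‖f x‖ₑ ≤ v n) :
    ∫⁻ x in s, ‖f x‖ₑ ^ p ∂halfLine ≤ ∑' n, ENNReal.ofReal (τ n) * v n ^ p := by
  have hmeas : ∀ n, MeasurableSet {x | σ n < ‖f x‖ₑ} := fun n =>
    measurableSet_lt measurable_const f.stronglyMeasurable.measurable.enorm
  calc ∫⁻ x in s, ‖f x‖ₑ ^ p ∂halfLine
      = ∫⁻ x, s.indicator (fun x => ‖f x‖ₑ ^ p) x ∂halfLine := (lintegral_indicator hs _).symm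
    _ ≤ ∫⁻ x, ∑' n, {x | σ n < ‖f x‖ₑ}.indicator (fun _ => v n ^ p) x ∂halfLine := by
      refine lintegral_mono_ae ?_
      filter_upwards [hcover] with x hx
      by_cases hxs : x ∈ s
      · rw [indicator_of_mem hxs]
        by_cases h0 : ‖f x‖ₑ = 0
        · rw [h0, ENNReal.zero_rpow_of_pos hp]
          exact zero_le
        · obtain ⟨n, hn1, hn2⟩ := hx hxs h0
          refine le_trans ?_ (ENNReal.le_tsum n)
          rw [indicator_of_mem (by exact hn1)]
          exact ENNReal.rpow_le_rpow hn2 hp.le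
      · rw [indicator_of_notMem hxs]
        exact zero_le
    _ = ∑' n, ∫⁻ x, {x | σ n < ‖f x‖ₑ}.indicator (fun _ => v n ^ p) x ∂halfLine :=
      lintegral_tsum fun n => (measurable_const.indicator (hmeas n)).aemeasurable
    _ ≤ ∑' n, ENNReal.ofReal (τ n) * v n ^ p := by
      refine ENNReal.tsum_le_tsum fun n => ?_
      rw [lintegral_indicator_const (hmeas n), mul_comm, ← hτ]
      gcongr
      exact measure_rearr_lt_enorm f _

theorem setLIntegral_rearr_lt_le {p b : ℝ} (hp : 0 < p) (hb : 1 < b) (t : ℝ) (f : MeasFun) :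
    ∫⁻ x in {x | rearr f t < ‖f x‖ₑ}, ‖f x‖ₑ ^ p ∂halfLine ≤
      ∑' n : ℕ, ENNReal.ofReal (t / b ^ n) * rearr f (t / b ^ (n + 1)) ^ p := by
  have hb0 : 0 < b := zero_lt_one.trans hb
  refine setLIntegral_le_tsum_of_cover hp f
    (measurableSet_lt measurable_const f.stronglyMeasurable.measurable.enorm) _
    (fun n => rearr f (t / b ^ n)) (fun n => t / b ^ n) (fun _ => rfl) ?_
  have hlim : Tendsto (fun n : ℕ => ENNReal.ofReal (t / b ^ (n + 1))) atTop (𝓝 0) := by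
    rw [← ENNReal.ofReal_zero]
    refine (ENNReal.continuous_ofReal.tendsto _).comp ?_
    exact tendsto_const_nhds.div_atTop
      ((tendsto_pow_atTop_atTop_of_one_lt hb).comp (tendsto_add_atTop_nat 1))
  -- Points where `|f|` exceeds every `f^*(t / b^(n+1))` form a set of measure at most `t / b^(n+1)`
  -- for all `n`, hence a null set. Elsewhere the first admissible `n` selects the layer.
  have hae : ∀ᵐ x ∂halfLine, ∃ n : ℕ, ‖f x‖ₑ ≤ rearr f (t / b ^ (n + 1)) := by
    rw [ae_iff]
    refine le_antisymm (ge_of_tendsto' hlim fun n => ?_) zero_le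
    refine (measure_mono fun x hx => ?_).trans (measure_rearr_lt_enorm f (t / b ^ (n + 1)))
    have hx' : ¬ ∃ n : ℕ, ‖f x‖ₑ ≤ rearr f (t / b ^ (n + 1)) := hx
    push Not at hx'
    exact hx' n
  classical
  filter_upwards [hae] with x hx hxs _
  refine ⟨Nat.find hx, ?_, Nat.find_spec hx⟩
  rcases h : Nat.find hx with _ | k
  · simpa using hxs
  · have := Nat.find_min hx (h ▸ k.lt_succ_self : k < Nat.find hx)
    exact not_le.1 this

theorem setLIntegral_le_rearr_le {p b t : ℝ} (hp : 0 < p) (hb : 1 < b) (ht : 0 < t) (f : MeasFun) :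
    ∫⁻ x in {x | ‖f x‖ₑ ≤ rearr f t}, ‖f x‖ₑ ^ p ∂halfLine ≤
      ∑' n : ℕ, ENNReal.ofReal (b ^ (n + 1) * t) * rearr f (b ^ n * t) ^ p := by
  by_cases htop : ∑' n : ℕ, ENNReal.ofReal (b ^ (n + 1) * t) * rearr f (b ^ n * t) ^ p = ∞
  · rw [htop]; exact le_top
  refine setLIntegral_le_tsum_of_cover hp f
    (measurableSet_le f.stronglyMeasurable.measurable.enorm measurable_const) _
    (fun n => rearr f (b ^ (n + 1) * t)) (fun n => b ^ (n + 1) * t) (fun _ => rfl) ?_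
  refine Eventually.of_forall fun x hxs h0 => ?_
  -- If `|f x| > 0` stayed below all `f^*(b^n t)`, each term of the right-hand series would be at
  -- least `t |f x|^p`, contradicting its convergence.
  have hex : ∃ n : ℕ, rearr f (b ^ (n + 1) * t) < ‖f x‖ₑ := by
    by_contra! hcon
    have hle : ∀ n : ℕ, ‖f x‖ₑ ≤ rearr f (b ^ n * t) := fun n => by
      rcases n with _ | n
      · simpa using hxs
      · exact hcon n
    refine htop (top_le_iff.1 ?_)
    have hc : ENNReal.ofReal t * ‖f x‖ₑ ^ p ≠ 0 := by
      refine mul_ne_zero (ENNReal.ofReal_pos.2 ht).ne' ?_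
      simp [ENNReal.rpow_eq_zero_iff, h0]
    rw [← ENNReal.tsum_const_eq_top_of_ne_zero (α := ℕ) hc]
    refine ENNReal.tsum_le_tsum fun n => ?_
    gcongr
    · exact le_mul_of_one_le_left ht.le (one_le_pow₀ hb.le)
    · exact hle n
  classical
  refine ⟨Nat.find hex, Nat.find_spec hex, ?_⟩
  rcases h : Nat.find hex with _ | k
  · simpa using hxs
  · have := Nat.find_min hex (h ▸ k.lt_succ_self : k < Nat.find hex)
    exact not_lt.1 this

/-- Each `y_n` is at most the whole sum, and the weights `2^{-n}` are summable. This passes from an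
`ℓ^p` to an `ℓ^1` expression for every `p > 0`, at the price of a geometric weight. -/
theorem tsum_half_pow_mul_rpow_le {p : ℝ} (hp : 0 < p) (y : ℕ → ℝ≥0∞) :
    (∑' n, 2⁻¹ ^ n * y n ^ p) ^ (1 / p) ≤ ENNReal.ofReal (2 ^ (1 / p)) * ∑' n, y n := by
  have h : ∑' n, 2⁻¹ ^ n * y n ^ p ≤ 2 * (∑' n, y n) ^ p := by
    calc ∑' n, 2⁻¹ ^ n * y n ^ p ≤ ∑' n, 2⁻¹ ^ n * (∑' n, y n) ^ p := by
          refine ENNReal.tsum_le_tsum fun n => ?_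
          gcongr
          exact ENNReal.le_tsum n
      _ = 2 * (∑' n, y n) ^ p := by
          rw [ENNReal.tsum_mul_right, ENNReal.tsum_geometric, ENNReal.one_sub_inv_two, inv_inv]
  calc _ ≤ (2 * (∑' n, y n) ^ p) ^ (1 / p) := ENNReal.rpow_le_rpow h (by positivity)
    _ = _ := by
      rw [ENNReal.mul_rpow_of_nonneg _ _ (by positivity), ← ENNReal.rpow_mul,
        mul_one_div_cancel hp.ne', ENNReal.rpow_one,
        ← ENNReal.ofReal_rpow_of_nonneg zero_le_two (by positivity), ENNReal.ofReal_ofNat]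

theorem tsum_weighted_rpow_le {p A ϑ : ℝ} (hp : 0 < p) (hA : 0 ≤ A) (hϑ : 0 ≤ ϑ) (w : ℕ → ℝ)
    (hw : ∀ n, w n = A * (2⁻¹ * ϑ ^ p) ^ n) (R : ℕ → ℝ≥0∞) :
    (∑' n, ENNReal.ofReal (w n) * R n ^ p) ^ (1 / p) ≤
      ENNReal.ofReal ((2 * A) ^ (1 / p)) * ∑' n, ENNReal.ofReal (ϑ ^ n) * R n := by
  have h : ∀ n, ENNReal.ofReal (w n) * R n ^ p =
      ENNReal.ofReal A * (2⁻¹ ^ n * (ENNReal.ofReal (ϑ ^ n) * R n) ^ p) := fun n => by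
    rw [hw, ENNReal.mul_rpow_of_nonneg _ _ hp.le,
      ENNReal.ofReal_rpow_of_nonneg (by positivity) hp.le, ← Real.rpow_natCast ϑ n,
      ← Real.rpow_mul hϑ, mul_comm (n : ℝ) p, Real.rpow_mul hϑ, Real.rpow_natCast, mul_pow,
      ENNReal.ofReal_mul hA, ENNReal.ofReal_mul (by positivity), ENNReal.ofReal_pow (by positivity),
      ENNReal.ofReal_inv_of_pos two_pos, ENNReal.ofReal_ofNat]
    ring
  simp only [h]
  rw [ENNReal.tsum_mul_left, ENNReal.mul_rpow_of_nonneg _ _ (by positivity),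
    ENNReal.ofReal_rpow_of_nonneg hA (by positivity), mul_comm 2 A,
    Real.mul_rpow hA zero_le_two, ENNReal.ofReal_mul (by positivity), mul_assoc]
  gcongr
  exact tsum_half_pow_mul_rpow_le hp _

theorem eLpNorm_truncGT_le {p b t : ℝ} (hp : 0 < p) (hb : 1 < b) (ht : 0 < t) (f : MeasFun) :
    ENNReal.ofReal (t ^ (-(1 / p))) *
        eLpNorm (truncGT f (rearr f t)) (ENNReal.ofReal p) halfLine ≤
      ENNReal.ofReal (2 ^ (1 / p)) *
        ∑' n : ℕ, ENNReal.ofReal (((2 / b) ^ (1 / p)) ^ n) * rearr f (t / b ^ (n + 1)) := by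
  have hb0 : 0 < b := zero_lt_one.trans hb
  rw [truncGT, eLpNorm_congr_ae (AEEqFun.coeFn_mk _ _), eLpNorm_indicator_eq
    (ENNReal.ofReal_pos.2 hp).ne' ENNReal.ofReal_ne_top _
    (measurableSet_lt measurable_const f.stronglyMeasurable.measurable.enorm),
    ENNReal.toReal_ofReal hp.le]
  have h := (ENNReal.rpow_le_rpow (setLIntegral_rearr_lt_le hp hb t f)
    (by positivity : 0 ≤ 1 / p)).trans
    -- `ϑ` is chosen so that `ϑ^p / 2 = 1/b`, the ratio of the weights `t / b^n`.
    (tsum_weighted_rpow_le (A := t) (ϑ := (2 / b) ^ (1 / p)) hp ht.le (by positivity) _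
      (fun n => ?_) _)
  · refine (mul_le_mul_right h _).trans ?_
    rw [← mul_assoc, ← ENNReal.ofReal_mul (by positivity), Real.mul_rpow zero_le_two ht.le,
      mul_left_comm, ← Real.rpow_add ht, neg_add_cancel, Real.rpow_zero, mul_one]
  · rw [← Real.rpow_mul (by positivity), one_div_mul_cancel hp.ne', Real.rpow_one]
    rw [show (2 : ℝ)⁻¹ * (2 / b) = b⁻¹ by field_simp, inv_pow, div_eq_mul_inv]

theorem eLpNorm_truncLE_le {p b t : ℝ} (hp : 0 < p) (hb : 1 < b) (ht : 0 < t) (f : MeasFun) :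
    ENNReal.ofReal (t ^ (-(1 / p))) *
        eLpNorm (truncLE f (rearr f t)) (ENNReal.ofReal p) halfLine ≤
      ENNReal.ofReal ((2 * b) ^ (1 / p)) *
        ∑' n : ℕ, ENNReal.ofReal (((2 * b) ^ (1 / p)) ^ n) * rearr f (b ^ n * t) := by
  have hb0 : 0 < b := zero_lt_one.trans hb
  rw [truncLE, eLpNorm_congr_ae (AEEqFun.coeFn_mk _ _), eLpNorm_indicator_eq
    (ENNReal.ofReal_pos.2 hp).ne' ENNReal.ofReal_ne_top _
    (measurableSet_le f.stronglyMeasurable.measurable.enorm measurable_const),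
    ENNReal.toReal_ofReal hp.le]
  have h := (ENNReal.rpow_le_rpow (setLIntegral_le_rearr_le hp hb ht f)
    (by positivity : 0 ≤ 1 / p)).trans
    -- Here `ϑ^p / 2 = b`, the ratio of the weights `b^(n+1) t`.
    (tsum_weighted_rpow_le (A := b * t) (ϑ := (2 * b) ^ (1 / p)) hp (by positivity) (by positivity)
      _ (fun n => ?_) _)
  · refine (mul_le_mul_right h _).trans ?_
    rw [← mul_assoc, ← ENNReal.ofReal_mul (by positivity), ← mul_assoc 2 b t,
      Real.mul_rpow (by positivity) ht.le,
      mul_left_comm, ← Real.rpow_add ht, neg_add_cancel, Real.rpow_zero, mul_one]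
  · rw [← Real.rpow_mul (by positivity), one_div_mul_cancel hp.ne', Real.rpow_one]
    rw [show (2 : ℝ)⁻¹ * (2 * b) = b by field_simp]
    ring

theorem eLpNorm_truncLE_top_le (f : MeasFun) (s : ℝ≥0∞) : eLpNorm (truncLE f s) ∞ halfLine ≤ s := by
  rw [truncLE, eLpNorm_congr_ae (AEEqFun.coeFn_mk _ _), eLpNorm_exponent_top]
  refine eLpNormEssSup_le_of_ae_enorm_bound (Eventually.of_forall fun x => ?_)
  by_cases hx : ‖f x‖ₑ ≤ s
  · rw [indicator_of_mem (by exact hx)]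
    exact hx
  · rw [indicator_of_notMem (by exact hx)]
    simp

/-! ### Boyd indices and geometric series of dilations -/

theorem exists_one_lt_mul_rpow_neg_le {e : ℝ} (he : 0 < e) (M : ℝ) :
    ∃ b : ℝ, 1 < b ∧ M * b ^ (-e) ≤ 2⁻¹ := by
  have h : Tendsto (fun b : ℝ => M * b ^ (-e)) atTop (𝓝 (M * 0)) :=
    (tendsto_rpow_neg_atTop he).const_mul M
  rw [mul_zero] at h
  obtain ⟨b, hb1, hb2⟩ := ((eventually_gt_atTop 1).and
    (h.eventually_le_const (by norm_num : (0 : ℝ) < 2⁻¹))).exists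
  exact ⟨b, hb1, hb2⟩

namespace RIQuasiBanachSpace

variable (E : RIQuasiBanachSpace)

theorem evalNonneg_tsum_geometric_le {C : ℝ≥0}
    (hC : ∀ g h : ℝ → ℝ≥0∞, AEMeasurable g halfLine → AEMeasurable h halfLine →
      evalNonneg E.ρ (fun t => g t + h t) ≤ C * (evalNonneg E.ρ g + evalNonneg E.ρ h))
    {g : ℕ → ℝ → ℝ≥0∞} (hg : ∀ n, AEMeasurable (g n) halfLine) {A r : ℝ} (hA : 0 ≤ A)
    (hr : 0 ≤ r) (hCr : C * r ≤ 2⁻¹) {B : ℝ≥0∞}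
    (h : ∀ n, evalNonneg E.ρ (g n) ≤ ENNReal.ofReal (A * r ^ n) * B) :
    evalNonneg E.ρ (fun t => ∑' n, g n t) ≤ ENNReal.ofReal (2 * (C * A)) * B := by
  refine (E.evalNonneg_tsum_le hC g hg).trans ?_
  have hterm : ∀ n, (C : ℝ≥0∞) ^ (n + 1) * evalNonneg E.ρ (g n) ≤
      2⁻¹ ^ n * (ENNReal.ofReal (C * A) * B) := fun n => by
    calc (C : ℝ≥0∞) ^ (n + 1) * evalNonneg E.ρ (g n)
        ≤ (C : ℝ≥0∞) ^ (n + 1) * (ENNReal.ofReal (A * r ^ n) * B) := by gcongr; exact h n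
      _ = ENNReal.ofReal ((C * r) ^ n * (C * A)) * B := by
        rw [← mul_assoc, ← ENNReal.ofReal_coe_nnreal, ← ENNReal.ofReal_pow C.coe_nonneg,
          ← ENNReal.ofReal_mul (by positivity)]
        congr 2
        ring
      _ ≤ ENNReal.ofReal (2⁻¹ ^ n * (C * A)) * B := by gcongr
      _ = 2⁻¹ ^ n * (ENNReal.ofReal (C * A) * B) := by
        rw [ENNReal.ofReal_mul (by positivity), ENNReal.ofReal_pow (by positivity),
          ENNReal.ofReal_inv_of_pos two_pos, ENNReal.ofReal_ofNat, mul_assoc]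
  refine (ENNReal.tsum_le_tsum hterm).trans ?_
  rw [ENNReal.tsum_mul_right, ENNReal.tsum_geometric, ENNReal.one_sub_inv_two, inv_inv,
    ENNReal.ofReal_mul zero_le_two, ENNReal.ofReal_ofNat, mul_assoc]

theorem evalNonneg_ofReal_mul_rearr_le {a B c : ℝ} (ha : 0 < a) (hc : 0 < c)
    (h : E.dilationNorm a ha ≤ ENNReal.ofReal B) {f : MeasFun} (hf : E.norm f < ∞) :
    evalNonneg E.ρ (fun t => ENNReal.ofReal c * rearr f (a * t)) ≤
      ENNReal.ofReal (c * B) * E.norm f := by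
  have hm : AEMeasurable (fun t => rearr f (a * t)) halfLine :=
    ((measurable_rearr f).comp (measurable_const_mul a)).aemeasurable
  refine (E.evalNonneg_const_mul_le (Real.toNNReal_pos.2 hc).ne' hm).trans ?_
  rw [ENNReal.ofReal_mul hc.le, mul_assoc]
  exact mul_le_mul_right (E.evalNonneg_rearr_dilate_le ha h hf) _

/-- Some `p > p₀` satisfies `‖D_a‖ ≤ c a^{-1/p}` for `a < 1`. With `a = b^{-(n+1)}`, the weighted
terms have ratio `2^{1/p₀} b^{-(1/p₀ - 1/p)}`, which is small for large `b`. -/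
theorem exists_evalNonneg_series_lower {p₀ : ℝ} (hp₀ : 0 < p₀)
    (hE : ENNReal.ofReal p₀ < E.lowerBoyd) :
    ∃ b : ℝ, 1 < b ∧ ∃ D : ℝ, ∀ f : MeasFun, E.norm f < ∞ →
      evalNonneg E.ρ (fun t => ∑' n : ℕ, ENNReal.ofReal (((2 / b) ^ (1 / p₀)) ^ n) *
        rearr f (t / b ^ (n + 1))) ≤ ENNReal.ofReal D * E.norm f := by
  obtain ⟨C, hC1, hC⟩ := E.exists_evalNonneg_add_le
  obtain ⟨P, ⟨p, hp, rfl, c, hc, hdil⟩, hlt⟩ := lt_sSup_iff.1 hE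
  have hpp : p₀ < p := (ENNReal.ofReal_lt_ofReal_iff hp).1 hlt
  have he : 0 < 1 / p₀ - 1 / p := sub_pos.2 (one_div_lt_one_div_of_lt hp₀ hpp)
  obtain ⟨b, hb, hbM⟩ := exists_one_lt_mul_rpow_neg_le he (C * 2 ^ (1 / p₀))
  have hb0 : 0 < b := zero_lt_one.trans hb
  refine ⟨b, hb, 2 * (C * (c * b ^ (1 / p))), fun f hf => ?_⟩
  refine E.evalNonneg_tsum_geometric_le hC (r := (2 / b) ^ (1 / p₀) * b ^ (1 / p))
    (fun n => (((measurable_rearr f).comp (measurable_id.div_const _)).const_mul _).aemeasurable)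
    (by positivity) (by positivity) ?_ fun n => ?_
  · refine le_trans (le_of_eq ?_) hbM
    rw [Real.div_rpow zero_le_two hb0.le, neg_sub, Real.rpow_sub hb0]
    ring
  · have ha : 0 < (b ^ (n + 1))⁻¹ := by positivity
    have ha1 : (b ^ (n + 1))⁻¹ < 1 := inv_lt_one_of_one_lt₀ (one_lt_pow₀ hb n.succ_ne_zero)
    have h := E.evalNonneg_ofReal_mul_rearr_le (c := ((2 / b) ^ (1 / p₀)) ^ n) ha (by positivity)
      (hdil _ ha ha1) hf
    have hpow : ((b ^ (n + 1))⁻¹) ^ (-(1 / p)) = (b ^ (1 / p)) ^ (n + 1) := by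
      rw [Real.inv_rpow (by positivity), Real.rpow_neg (by positivity), inv_inv,
        ← Real.rpow_natCast, ← Real.rpow_natCast, ← Real.rpow_mul hb0.le, ← Real.rpow_mul hb0.le,
        mul_comm]
    rw [hpow] at h
    simp only [div_eq_inv_mul _ (b ^ (n + 1))]
    refine h.trans (le_of_eq ?_)
    congr 2
    ring

/-- Dually, some `q < p₁` satisfies `‖D_a‖ ≤ c a^{-1/q}` for `a ≥ 1`. With `a = b^n` the ratio is
`2^{1/p₁} b^{-(1/q - 1/p₁)}`. -/
theorem exists_evalNonneg_series_upper {p₁ : ℝ} (hp₁ : 0 < p₁)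
    (hE : E.upperBoyd < ENNReal.ofReal p₁) :
    ∃ b : ℝ, 1 < b ∧ ∃ D : ℝ, ∀ f : MeasFun, E.norm f < ∞ →
      evalNonneg E.ρ (fun t => ∑' n : ℕ, ENNReal.ofReal (((2 * b) ^ (1 / p₁)) ^ n) *
        rearr f (b ^ n * t)) ≤ ENNReal.ofReal D * E.norm f := by
  obtain ⟨C, hC1, hC⟩ := E.exists_evalNonneg_add_le
  obtain ⟨Q, ⟨q, hq, rfl, c, hc, hdil⟩, hlt⟩ := sInf_lt_iff.1 hE
  have hqp : q < p₁ := (ENNReal.ofReal_lt_ofReal_iff hp₁).1 hlt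
  have he : 0 < 1 / q - 1 / p₁ := sub_pos.2 (one_div_lt_one_div_of_lt hq hqp)
  obtain ⟨b, hb, hbM⟩ := exists_one_lt_mul_rpow_neg_le he (C * 2 ^ (1 / p₁))
  have hb0 : 0 < b := zero_lt_one.trans hb
  refine ⟨b, hb, 2 * (C * c), fun f hf => ?_⟩
  refine E.evalNonneg_tsum_geometric_le hC (r := (2 * b) ^ (1 / p₁) * b ^ (-(1 / q)))
    (fun n => (((measurable_rearr f).comp (measurable_const_mul _)).const_mul _).aemeasurable)
    hc.le (by positivity) ?_ fun n => ?_
  · refine le_trans (le_of_eq ?_) hbM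
    rw [Real.mul_rpow zero_le_two hb0.le, neg_sub, sub_eq_add_neg, Real.rpow_add hb0]
    ring
  · have h := E.evalNonneg_ofReal_mul_rearr_le (c := ((2 * b) ^ (1 / p₁)) ^ n)
      (by positivity : 0 < b ^ n) (by positivity) (hdil _ _ (one_le_pow₀ hb.le)) hf
    have hpow : (b ^ n) ^ (-(1 / q)) = (b ^ (-(1 / q))) ^ n := by
      rw [← Real.rpow_natCast, ← Real.rpow_natCast, ← Real.rpow_mul hb0.le, ← Real.rpow_mul hb0.le,
        mul_comm]
    rw [hpow] at h
    refine h.trans (le_of_eq ?_)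
    congr 2
    ring

/-! ### Interpolation of the Lebesgue couple -/

theorem measurable_rpow_mul_peetreK {V : Type*} [AddCommGroup V] (N₀ N₁ : V → ℝ≥0∞) (α θ : ℝ)
    (x : V) :
    Measurable fun t : ℝ => ENNReal.ofReal (t ^ α) * peetreK N₀ N₁ (t ^ θ) x :=
  (measurable_id.pow_const α).ennreal_ofReal.mul
    ((peetreK_mono N₀ N₁ x).measurable.comp (measurable_id.pow_const θ))

theorem rpow_mul_peetreK_le {p₀ p₁ : ℝ≥0∞} {θ : ℝ} (h : θ = 1 / p₀.toReal - 1 / p₁.toReal)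
    (f : MeasFun) {t : ℝ} (ht : 0 < t) (s : ℝ≥0∞) :
    ENNReal.ofReal (t ^ (-(1 / p₀.toReal))) *
        peetreK (lebesgueQuasiNorm p₀) (lebesgueQuasiNorm p₁) (t ^ θ) f ≤
      ENNReal.ofReal (t ^ (-(1 / p₀.toReal))) * eLpNorm (truncGT f s) p₀ halfLine +
      ENNReal.ofReal (t ^ (-(1 / p₁.toReal))) * eLpNorm (truncLE f s) p₁ halfLine := by
  refine (mul_le_mul_right (peetreK_le_add _ _ (Real.rpow_pos_of_pos ht θ)
    (truncGT_add_truncLE f s)) _).trans (le_of_eq ?_)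
  rw [mul_add, ← mul_assoc, ← ENNReal.ofReal_mul (by positivity), ← Real.rpow_add ht,
    show -(1 / p₀.toReal) + θ = -(1 / p₁.toReal) by rw [h]; ring]
  rfl

theorem exists_dominating_truncLE {p₁ : ℝ≥0∞} (hp₁ : p₁ ≠ 0) (hE : E.upperBoyd < p₁ ∨ p₁ = ∞) :
    ∃ D : ℝ, ∀ f : MeasFun, E.norm f < ∞ → ∃ Z : ℝ → ℝ≥0∞, Measurable Z ∧
      (∀ t, 0 < t → ENNReal.ofReal (t ^ (-(1 / p₁.toReal))) *
        eLpNorm (truncLE f (rearr f t)) p₁ halfLine ≤ Z t) ∧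
      evalNonneg E.ρ Z ≤ ENNReal.ofReal D * E.norm f := by
  by_cases htop : p₁ = ∞
  · subst htop
    -- For `p₁ = ∞` the lower part is bounded by `f^*(t)` itself, so no upper Boyd index enters.
    refine ⟨1, fun f _ => ⟨rearr f, measurable_rearr f, fun t _ => ?_, ?_⟩⟩
    · simpa using eLpNorm_truncLE_top_le f (rearr f t)
    · rw [ENNReal.ofReal_one, one_mul]
      exact le_rfl
  · replace hE := hE.resolve_right htop
    have hpos : 0 < p₁.toReal := ENNReal.toReal_pos hp₁ htop
    obtain ⟨b, hb, D, hD⟩ := E.exists_evalNonneg_series_upper hpos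
      (by rwa [ENNReal.ofReal_toReal htop])
    have hb0 : 0 < b := zero_lt_one.trans hb
    have hc : 0 < (2 * b) ^ (1 / p₁.toReal) := by positivity
    refine ⟨(2 * b) ^ (1 / p₁.toReal) * D, fun f hf => ?_⟩
    have hm : Measurable fun t => ∑' n : ℕ, ENNReal.ofReal (((2 * b) ^ (1 / p₁.toReal)) ^ n) *
        rearr f (b ^ n * t) := Measurable.tsum fun n =>
      ((measurable_rearr f).comp (measurable_const_mul _)).const_mul _
    refine ⟨_, hm.const_mul (ENNReal.ofReal ((2 * b) ^ (1 / p₁.toReal))), fun t ht => ?_, ?_⟩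
    · have := eLpNorm_truncLE_le hpos hb ht f
      rw [ENNReal.ofReal_toReal htop] at this
      exact this
    · refine (E.evalNonneg_const_mul_le (Real.toNNReal_pos.2 hc).ne' hm.aemeasurable).trans ?_
      rw [ENNReal.ofReal_mul hc.le, mul_assoc]
      exact mul_le_mul_right (hD f hf) _

theorem exists_interpQuasiNorm_le {p₀ : ℝ} {p₁ : ℝ≥0∞} {Θ : ℝ} (hp₀ : 0 < p₀) (hp₁ : p₁ ≠ 0)
    (hE : ENNReal.ofReal p₀ < E.lowerBoyd) (hE' : E.upperBoyd < p₁ ∨ p₁ = ∞)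
    (hΘ : 1 / Θ = 1 / p₀ - 1 / p₁.toReal) :
    ∃ D : ℝ≥0∞, D ≠ ∞ ∧ ∀ f : MeasFun, E.norm f < ∞ →
      E.interpQuasiNorm (lebesgueQuasiNorm (ENNReal.ofReal p₀)) (lebesgueQuasiNorm p₁) Θ p₀ f ≤
        D * E.norm f := by
  obtain ⟨C, hC1, hC⟩ := E.exists_evalNonneg_add_le
  obtain ⟨b, hb, D₀, hD₀⟩ := E.exists_evalNonneg_series_lower hp₀ hE
  obtain ⟨D₁, hD₁⟩ := E.exists_dominating_truncLE hp₁ hE'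
  refine ⟨C * (ENNReal.ofReal (2 ^ (1 / p₀)) * ENNReal.ofReal D₀ + ENNReal.ofReal D₁),
    by finiteness, fun f hf => ?_⟩
  obtain ⟨Z, hZm, hZ, hZE⟩ := hD₁ f hf
  have hY : Measurable fun t => ∑' n : ℕ, ENNReal.ofReal (((2 / b) ^ (1 / p₀)) ^ n) *
      rearr f (t / b ^ (n + 1)) := Measurable.tsum fun n =>
    ((measurable_rearr f).comp (measurable_id.div_const _)).const_mul _
  have hc : (0 : ℝ) < 2 ^ (1 / p₀) := by positivity
  have htoReal : (ENNReal.ofReal p₀).toReal = p₀ := ENNReal.toReal_ofReal hp₀.le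
  refine (E.evalNonneg_mono (measurable_rpow_mul_peetreK _ _ _ _ _).aemeasurable ?_).trans
    ((hC _ Z (hY.const_mul (ENNReal.ofReal (2 ^ (1 / p₀)))).aemeasurable hZm.aemeasurable).trans ?_)
  · filter_upwards [ae_restrict_mem measurableSet_Ioi] with t ht
    have h := rpow_mul_peetreK_le (p₀ := ENNReal.ofReal p₀) (p₁ := p₁) (θ := 1 / Θ)
      (by rw [htoReal, hΘ]) f ht (rearr f t)
    rw [htoReal] at h
    exact h.trans (add_le_add (eLpNorm_truncGT_le hp₀ hb ht f) (hZ t ht))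
  · rw [mul_assoc, add_mul, mul_assoc]
    gcongr
    exact (E.evalNonneg_const_mul_le (Real.toNNReal_pos.2 hc).ne' hY.aemeasurable).trans
      (mul_le_mul_right (hD₀ f hf) _)

theorem norm_le_interpQuasiNorm {p₀ : ℝ} {p₁ : ℝ≥0∞} {Θ : ℝ} (hp₀ : 0 < p₀) (hp₁ : p₁ ≠ 0)
    (hΘ : 1 / Θ = 1 / p₀ - 1 / p₁.toReal) (hΘ0 : 0 ≤ 1 / Θ) (f : MeasFun) :
    E.norm f ≤ ENNReal.ofReal (2 ^ (1 / p₀)) *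
      E.interpQuasiNorm (lebesgueQuasiNorm (ENNReal.ofReal p₀)) (lebesgueQuasiNorm p₁) Θ p₀ f := by
  have hc : (0 : ℝ) < 2 ^ (1 / p₀) := by positivity
  have htoReal : (ENNReal.ofReal p₀).toReal = p₀ := ENNReal.toReal_ofReal hp₀.le
  refine (E.evalNonneg_mono (measurable_rearr f).aemeasurable ?_).trans
    (E.evalNonneg_const_mul_le (Real.toNNReal_pos.2 hc).ne'
      (measurable_rpow_mul_peetreK _ _ _ _ _).aemeasurable)
  filter_upwards [ae_restrict_mem measurableSet_Ioi] with t ht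
  have h := rearr_le_peetreK (p₀ := ENNReal.ofReal p₀) (ENNReal.ofReal_pos.2 hp₀).ne' hp₁ hΘ0
    (by rw [htoReal, hΘ]) f ht
  rw [htoReal] at h
  exact h

/-! ### Testing on characteristic functions: control of `K(1, x)` -/

theorem evalNonneg_indicator_one_lt_top {ω : Set ℝ} (hω : MeasurableSet ω)
    (hfin : halfLine ω < ∞) : evalNonneg E.ρ (ω.indicator fun _ => 1) < ∞ := by
  have hm : Measurable (ω.indicator fun _ : ℝ => (1 : ℝ≥0∞)) := measurable_const.indicator hω
  rw [evalNonneg_eq _ hm.aemeasurable (Eventually.of_forall fun t =>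
    (indicator_le_self' (fun _ _ => zero_le) _).trans_lt ENNReal.one_lt_top)]
  refine (E.lattice (charFun ω hω) _ ?_).trans_lt (E.finite_charFun ω hω hfin)
  filter_upwards [coeFn_ofNonneg _ hm.aemeasurable, coeFn_charFun hω] with t h1 h2
  rw [h1, h2]
  by_cases ht : t ∈ ω <;> simp [ht]

/-- On `(1, 2)` one has `t^{-1/r} ≥ 2^{-1/r}` and `K(t^{1/Θ}, x) ≥ K(1, x)`. So `K(1, x)` times a
fixed nonzero function is dominated by the function defining the interpolation quasi-norm. -/
theorem exists_peetreK_one_le (r : ℝ) (hr : 0 < r) {Θ : ℝ} (hΘ : 0 ≤ 1 / Θ) {V : Type*}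
    [AddCommGroup V] (N₀ N₁ : V → ℝ≥0∞) :
    ∃ D : ℝ≥0∞, D ≠ ∞ ∧ ∀ x : V, peetreK N₀ N₁ 1 x ≤ D * E.interpQuasiNorm N₀ N₁ Θ r x := by
  let χ : ℝ → ℝ≥0∞ := (Ioo 1 2).indicator fun _ => ENNReal.ofReal (2 ^ (-(1 / r)))
  have hχ : Measurable χ := measurable_const.indicator measurableSet_Ioo
  have hχfin : ∀ᵐ t ∂halfLine, χ t < ∞ := Eventually.of_forall fun t =>
    (indicator_le_self' (fun _ _ => zero_le) _).trans_lt ENNReal.ofReal_lt_top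
  have hχ0 : evalNonneg E.ρ χ ≠ 0 := fun h0 => by
    have h1 := E.ae_eq_zero_of_evalNonneg_eq_zero h0
    have h2 : halfLine {t | ¬ χ t = 0} = 0 := h1
    have h3 : Ioo (1 : ℝ) 2 ⊆ {t | ¬ χ t = 0} := fun t ht => by
      change ¬ χ t = 0
      rw [show χ t = ENNReal.ofReal (2 ^ (-(1 / r))) from indicator_of_mem ht _]
      exact (ENNReal.ofReal_pos.2 (by positivity)).ne'
    have h4 := measure_mono_null h3 h2
    rw [Measure.restrict_apply measurableSet_Ioo, inter_eq_self_of_subset_left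
      (Ioo_subset_Ioi_self.trans (Ioi_subset_Ioi zero_le_one)), Real.volume_Ioo] at h4
    norm_num at h4
  refine ⟨(evalNonneg E.ρ χ)⁻¹, ENNReal.inv_ne_top.2 hχ0, fun x => ?_⟩
  rw [mul_comm, ← div_eq_mul_inv]
  -- `K(1, x)` may be infinite, so homogeneity of `ρ` is applied to finite `k < K(1, x)`.
  refine ENNReal.le_of_forall_nnreal_lt fun k hk => ?_
  refine ENNReal.le_div_iff_mul_le (Or.inl hχ0) ?_ |>.2 ?_
  · refine Or.inl (ne_top_of_le_ne_top (E.evalNonneg_indicator_one_lt_top measurableSet_Ioo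
      (ω := Ioo 1 2) ?_).ne (E.evalNonneg_mono hχ.aemeasurable (Eventually.of_forall fun t => ?_)))
    · exact (Measure.restrict_apply_le _ _).trans_lt (by simp)
    · refine indicator_le_indicator ?_
      exact ENNReal.ofReal_le_one.2
        (Real.rpow_le_one_of_one_le_of_nonpos one_le_two (by simp [hr.le]))
  · rw [← E.evalNonneg_const_mul k hχ.aemeasurable hχfin]
    refine E.evalNonneg_mono (hχ.const_mul _).aemeasurable (Eventually.of_forall fun t => ?_)
    by_cases ht : t ∈ Ioo (1 : ℝ) 2
    · have h0 : 0 < t := zero_lt_one.trans ht.1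
      rw [show χ t = ENNReal.ofReal (2 ^ (-(1 / r))) from indicator_of_mem ht _, mul_comm]
      refine mul_le_mul' (ENNReal.ofReal_le_ofReal ?_)
        (hk.le.trans (peetreK_mono N₀ N₁ x (Real.one_le_rpow ht.1.le hΘ)))
      exact Real.rpow_le_rpow_of_nonpos h0 ht.2.le (by simp [hr.le])
    · rw [show χ t = 0 from indicator_of_notMem ht _, mul_zero]
      exact zero_le

end RIQuasiBanachSpace

/-! ### The test function `χ_(0,1)` and the final embeddings -/

theorem contEmbedded_of_le {V : Type*} {N M : V → ℝ≥0∞} {A : ℝ≥0∞} (hA : A ≠ ∞)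
    (h : ∀ x, N x < ∞ → M x ≤ A * N x) : ContEmbedded N M := by
  refine ⟨A.toNNReal + 1, by positivity, fun x hx => (h x hx).trans ?_⟩
  gcongr
  rw [ENNReal.coe_add, ENNReal.coe_toNNReal hA]
  exact le_self_add

theorem measure_lt_enorm_charFun {ω : Set ℝ} (hω : MeasurableSet ω) (s : ℝ≥0∞) :
    halfLine {x | s < ‖charFun ω hω x‖ₑ} = if s < 1 then halfLine ω else 0 := by
  have h : {x | s < ‖charFun ω hω x‖ₑ} =ᵐ[halfLine] {x | s < 1 ∧ x ∈ ω} := by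
    filter_upwards [coeFn_charFun hω] with x hx
    change (s < ‖charFun ω hω x‖ₑ) = (s < 1 ∧ x ∈ ω)
    rw [hx]
    by_cases hxω : x ∈ ω <;> simp [hxω]
  rw [measure_congr h]
  split_ifs with hs <;> simp [hs]

theorem halfLine_Ioo_zero_one : halfLine (Ioo 0 1) = 1 := by
  rw [Measure.restrict_apply measurableSet_Ioo, inter_eq_self_of_subset_left Ioo_subset_Ioi_self]
  simp

theorem RIQuasiBanachSpace.norm_charFun_Ioo_lt_top (E : RIQuasiBanachSpace) :
    E.norm (charFun (Ioo 0 1) measurableSet_Ioo) < ∞ := by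
  refine lt_of_le_of_lt (E.evalNonneg_mono (measurable_rearr _).aemeasurable ?_)
    (E.evalNonneg_indicator_one_lt_top (ω := Ioo 0 1) measurableSet_Ioo
      (halfLine_Ioo_zero_one.trans_lt ENNReal.one_lt_top))
  filter_upwards [ae_restrict_mem measurableSet_Ioi] with t ht
  by_cases h1 : t < 1
  · rw [indicator_of_mem (show t ∈ Ioo (0 : ℝ) 1 from ⟨ht, h1⟩)]
    refine sInf_le ⟨zero_lt_one, ?_⟩
    rw [measure_lt_enorm_charFun]
    simp
  · refine le_trans (le_of_forall_gt_imp_ge_of_dense fun s hs => sInf_le ⟨hs, ?_⟩) zero_le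
    rw [measure_lt_enorm_charFun, halfLine_Ioo_zero_one]
    have : 1 ≤ ENNReal.ofReal t := ENNReal.one_le_ofReal.2 (not_lt.1 h1)
    split_ifs
    · exact this
    · exact zero_le

theorem rearr_charFun_Ioo_ne_zero : rearr (charFun (Ioo 0 1) measurableSet_Ioo) (1 / 2) ≠ 0 := by
  intro h0
  have h := measure_rearr_lt_enorm (charFun (Ioo 0 1) measurableSet_Ioo) (1 / 2)
  rw [h0, measure_lt_enorm_charFun, if_pos zero_lt_one, halfLine_Ioo_zero_one,
    ENNReal.one_le_ofReal] at h
  norm_num at h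

theorem lebesgueQuasiNorm_zero (p : ℝ≥0∞) : lebesgueQuasiNorm p 0 = 0 := by
  rw [lebesgueQuasiNorm, eLpNorm_congr_ae AEEqFun.coeFn_zero]
  exact eLpNorm_zero

/-- `K(s, f) ≤ κ⁻¹ max(‖f‖₀, ‖f‖₁) K(s, x)`, where `κ = K(1, x)`. -/
theorem peetreK_mul_peetreK_one_le {V : Type*} [AddCommGroup V] {N₀ N₁ : V → ℝ≥0∞}
    (h₀ : N₀ 0 = 0) (h₁ : N₁ 0 = 0) {s : ℝ} (hs : 0 < s) (f x : V) :
    peetreK N₀ N₁ s f * peetreK N₀ N₁ 1 x ≤ interQuasiNorm N₀ N₁ f * peetreK N₀ N₁ s x := by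
  -- The trivial decompositions give `K(s, f) ≤ min(1, s) max(‖f‖₀, ‖f‖₁)`, while `K(s, x) ≥ min(1,
  -- s) K(1, x)`.
  rcases le_total 1 s with h | h
  · refine mul_le_mul' ?_ (peetreK_mono N₀ N₁ x h)
    refine (peetreK_le_add N₀ N₁ hs (add_zero f).symm).trans ?_
    rw [h₁, mul_zero, add_zero]
    exact le_max_left _ _
  · have hK : peetreK N₀ N₁ s f ≤ ENNReal.ofReal s * interQuasiNorm N₀ N₁ f := by
      refine (peetreK_le_add N₀ N₁ hs (zero_add f).symm).trans ?_
      rw [h₀, zero_add]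
      exact mul_le_mul_right (le_max_right _ _) _
    have hK1 : peetreK N₀ N₁ 1 x ≤ ENNReal.ofReal s⁻¹ * peetreK N₀ N₁ s x := by
      have := peetreK_mul_le N₀ N₁ ((one_le_inv₀ hs).2 h) s x
      rwa [inv_mul_cancel₀ hs.ne'] at this
    refine (mul_le_mul' hK hK1).trans (le_of_eq ?_)
    have hinv : ENNReal.ofReal s * ENNReal.ofReal s⁻¹ = 1 := by
      rw [← ENNReal.ofReal_mul hs.le, mul_inv_cancel₀ hs.ne', ENNReal.ofReal_one]
    rw [mul_mul_mul_comm, hinv, one_mul]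


theorem corollary16 (E : RIQuasiBanachSpace) (p₀ : ℝ) (p₁ : ℝ≥0∞) (Θ : ℝ)
    (hp₀ : 0 < p₀) (hp : ENNReal.ofReal p₀ < p₁)
    (hE : ENNReal.ofReal p₀ < E.lowerBoyd)
    (hΘ : (E.upperBoyd < p₁ ∧ p₁ < ∞ ∧ 1 / Θ = 1 / p₀ - 1 / p₁.toReal) ∨
      (p₁ = ∞ ∧ Θ = p₀)) :
    SameSpace
      (E.interpQuasiNorm (lebesgueQuasiNorm (ENNReal.ofReal p₀)) (lebesgueQuasiNorm p₁) Θ p₀)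
      E.norm ∧
    ContEmbedded
      (interQuasiNorm (lebesgueQuasiNorm (ENNReal.ofReal p₀)) (lebesgueQuasiNorm p₁))
      E.norm ∧
    ContEmbedded
      E.norm
      (sumQuasiNorm (lebesgueQuasiNorm (ENNReal.ofReal p₀)) (lebesgueQuasiNorm p₁)) := by
  have hp₁ : p₁ ≠ 0 := (zero_le.trans_lt hp).ne'
  have hE' : E.upperBoyd < p₁ ∨ p₁ = ∞ := hΘ.imp (fun h => h.1) fun h => h.1
  have hΘeq : 1 / Θ = 1 / p₀ - 1 / p₁.toReal := by
    rcases hΘ with h | ⟨rfl, rfl⟩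
    · exact h.2.2
    · simp
  have hΘ0 : 0 ≤ 1 / Θ := by
    rw [hΘeq, sub_nonneg]
    rcases eq_or_ne p₁ ∞ with rfl | htop
    · simpa using hp₀.le
    · exact one_div_le_one_div_of_le hp₀ ((ENNReal.ofReal_le_iff_le_toReal htop).1 hp.le)
  set N₀ := lebesgueQuasiNorm (ENNReal.ofReal p₀) with hN₀
  set N₁ := lebesgueQuasiNorm p₁ with hN₁
  have hlow := E.norm_le_interpQuasiNorm hp₀ hp₁ hΘeq hΘ0
  obtain ⟨D, hDtop, hup⟩ := E.exists_interpQuasiNorm_le hp₀ hp₁ hE hE' hΘeq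
  obtain ⟨S, hStop, hsum⟩ := E.exists_peetreK_one_le p₀ hp₀ hΘ0 N₀ N₁
  refine ⟨⟨contEmbedded_of_le ENNReal.ofReal_ne_top fun f _ => hlow f,
    contEmbedded_of_le hDtop hup⟩, ?_, ?_⟩
  -- `χ` lies in `E`, hence by `hup` in the interpolation space. Its `K`-functional therefore serves
  -- as a majorant with finite `ρ`-value for every `f` in the intersection.
  · set χ := charFun (Ioo 0 1) measurableSet_Ioo
    have hχE : E.norm χ < ∞ := E.norm_charFun_Ioo_lt_top
    set I := E.interpQuasiNorm N₀ N₁ Θ p₀ χ with hI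
    have hItop : I < ∞ := (hup χ hχE).trans_lt (ENNReal.mul_lt_top hDtop.lt_top hχE)
    set κ := peetreK N₀ N₁ 1 χ with hκ
    have hκtop : κ ≠ ∞ := ((hsum χ).trans_lt (ENNReal.mul_lt_top hStop.lt_top hItop)).ne
    -- If `K(1, χ)` vanished, so would `K` at the smaller argument `(1/2)^{1/Θ}`, forcing `χ^*(1/2)
    -- = 0`.
    have hκ0 : κ ≠ 0 := fun h0 => by
      have h := rearr_le_peetreK (p₀ := ENNReal.ofReal p₀) (ENNReal.ofReal_pos.2 hp₀).ne' hp₁ hΘ0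
        (by rw [ENNReal.toReal_ofReal hp₀.le, hΘeq]) χ (one_half_pos (α := ℝ))
      have hK : peetreK N₀ N₁ ((1 / 2) ^ (1 / Θ)) χ ≤ κ := peetreK_mono N₀ N₁ χ
        (Real.rpow_le_one (by norm_num) (by norm_num) hΘ0)
      rw [h0, nonpos_iff_eq_zero] at hK
      rw [hK, mul_zero, mul_zero, nonpos_iff_eq_zero] at h
      exact rearr_charFun_Ioo_ne_zero h
    obtain ⟨hFm, hFfin⟩ := ae_lt_top_of_evalNonneg hItop
    refine contEmbedded_of_le (A := ENNReal.ofReal (2 ^ (1 / p₀)) * (κ⁻¹ * I))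
      (by finiteness) fun f hf => (hlow f).trans ?_
    rw [mul_assoc, mul_comm (κ⁻¹ * I), ← mul_assoc (interQuasiNorm N₀ N₁ f)]
    refine mul_le_mul_right ?_ _
    have hc : interQuasiNorm N₀ N₁ f * κ⁻¹ ≠ ∞ := by finiteness
    rw [← ENNReal.coe_toNNReal hc, hI, RIQuasiBanachSpace.interpQuasiNorm,
      RIQuasiBanachSpace.interpQuasiNorm, ← E.evalNonneg_const_mul _ hFm hFfin]
    refine E.evalNonneg_mono
      (RIQuasiBanachSpace.measurable_rpow_mul_peetreK _ _ _ _ _).aemeasurable ?_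
    filter_upwards [ae_restrict_mem measurableSet_Ioi] with t ht
    rw [ENNReal.coe_toNNReal hc, mul_left_comm]
    refine mul_le_mul_right ?_ _
    rw [mul_right_comm, ← div_eq_mul_inv, ENNReal.le_div_iff_mul_le (Or.inl hκ0) (Or.inl hκtop)]
    exact peetreK_mul_peetreK_one_le (lebesgueQuasiNorm_zero _) (lebesgueQuasiNorm_zero _)
      (Real.rpow_pos_of_pos ht _) f χ
  · refine contEmbedded_of_le (A := S * D) (by finiteness) fun f hf => ?_
    rw [sumQuasiNorm_eq_peetreK, mul_assoc]
    exact (hsum f).trans (mul_le_mul_right (hup f hf) _)
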